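/- **Setting.** Let $n,m,B\ge 1$ be integers, $\gamma\in(0,1)$, and let $A_t=[a_{ij,t}]\in\mathbb R^{n\times n}$, $t\ge 0$, be column-stochastic matrices with nonnegative entries such that $a_{ii,t}>0$, every nonzero entry is at least $\gamma$, and for every $t\ge 1$ the digraph on $\{1,\dots,n\}$ with edges $\{(j,i): a_{ij,t+l}>0 \text{ for some } 0\le l\le B-1\}$ is strongly connected. Put $\phi_{i,0}=1$, $\phi_{i,t+1}=\sum_j a_{ij,t}\phi_{j,t}$, and let $\mathcal B_t$ be the matrix with entries $b_{ij,t}=a_{ij,t}\phi_{j,t}/\phi_{i,t+1}$. Call $C>0$, $\lambda\in(0,1)$, $\theta>0$ *admissible* if $\phi_{i,t}\ge\theta^{-1}$ for all $i,t$ and there are vectors $\pi_t\in\mathbb R^n$ with $\sum_i\pi_{i,t}=1$ and $|[\mathcal B_{s-1}\cdots\mathcal B_t]_{ij}-\pi_{j,t}|\le C\lambda^{s-t}$ for all $s\ge t\ge 0$ and all $i,j$ (the empty product being the identity). Let $\Omega\subseteq\mathbb R^m$ be nonempty, closed and convex with $r\mathbb B\subseteq\Omega\subseteq R\,\mathbb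 B$, where $r,R>0$ and $\mathbb B$ is the closed Euclidean unit ball. Let $f_{i,t}$ ($1\le i\le n$, $t\ge 0$) be real functions, convex on $\Omega$, and let $G>0$ be such that at every $x\in\Omega$ each $f_{i,t}$ has a subgradient $g$ (that is, $f_{i,t}(y)\ge f_{i,t}(x)+g^{\mathsf T}(y-x)$ for $y\in\Omega$) with $\|g\|\le G$. Put $F_t=\sum_i f_{i,t}$, let $x_t^\star\in\arg\min_{x\in\Omega}F_t(x)$ for $t\ge0$, and $\mathcal C_T=\sum_{t=0}^T\|x_{t+1}^\star-x_t^\star\|$. Let $\zeta_{i,t}$ be independent random vectors, uniform on the unit sphere of $\mathbb R^m$. For a horizon $T\ge 1$ put $\mu=\frac{r}{\sqrt{T+1}}$, $\xi=\frac1{\sqrt{T+1}}$, $\alpha_t=\frac{1}{m\sqrt{t+1}}$. From deterministic points $x_{i,0}\in(1-\xi)\Omega$ define $$x_{i,t+1}=\mathcal P_{(1-\xi)\Omega}\Big(\sum_{j}b_{ij,t}x_{j,t}-\frac{\alpha_t}{\phi_{i,t+1}}\,\hat g_{i,t}\Big),\qquad \hat g_{i,t}=\frac m\mu\big(f_{i,t}(x_{i,t}+\mu\zeta_{i,t})-f_{i,t}(x_{i,t})\big)\zeta_{i,t},$$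 where $\mathcal P_K$ is the Euclidean projection onto $K$, and let $$\mathcal R_j^d(T)=\mathbb E\Big[\sum_{t=0}^T F_t(x_{j,t})-\sum_{t=0}^TF_t(x_t^\star)\Big].$$ **Theorem (dynamic regret bound).** (i) There are $C,\lambda,\theta$, depending only on $n,\gamma,B$, that are admissible for every sequence $(A_t)$ as above. (ii) For all admissible $C,\lambda,\theta$, every $T\ge1$, all initial points $x_{i,0}\in(1-\xi)\Omega$ and every node $j$, the expectation above exists and $$\mathcal R_j^d(T)\le \mathcal K_1+\mathcal K_2\sqrt{T+1},$$ where $$\mathcal K_1=\frac{nC(2RL\theta+2m\theta\lambda G+G)}{1-\lambda}\sum_{i=1}^n\|x_{i,0}\|+\frac{2n^2\theta CGR}{\lambda(1-\lambda)},$$ $$\mathcal K_2=\frac{2n^2\theta CG}{1-\lambda}\big(2\theta RL+2m\theta G+G\big)+nm\theta^2G^2+2nmR^2+nr\theta G+n\theta GR+2nmR\,\mathcal C_T.$$ This holds with $L=mG/\mu$, and also with $L=G/R$, in which case $\mathcal K_1$ and $\mathcal K_2$ depend on $T$ only through the initial points (with $\|x_{i,0}\|\le R$) and $\mathcal C_T$,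 respectively. (iii) If $\mathcal C_T=o(\sqrt T)$ as $T\to\infty$, then, for any initial points $x_{i,0}=x_{i,0}^{(T)}\in(1-\xi)\Omega$ chosen for each horizon, $\mathcal R_j^d(T)/T\to0$ for every node $j$. -/

import Mathlib

open MeasureTheory ProbabilityTheory Filter Asymptotics
open scoped Pointwise

noncomputable section

namespace ZODOO

/-- The decision space `ℝ^m` with its Euclidean norm. -/
abbrev E (m : ℕ) : Type := EuclideanSpace ℝ (Fin m)

/-! ### Network -/

/-- The digraph induced by a weight matrix: `(j, i)` is an edge iff `a_{ij} > 0`. -/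
def inducedDigraph {n : ℕ} (M : Matrix (Fin n) (Fin n) ℝ) : Digraph (Fin n) where
  Adj j i := 0 < M i j

/-- Every node can be reached from every other one along a directed path. -/
def StronglyConnected {n : ℕ} (D : Digraph (Fin n)) : Prop :=
  ∀ i j : Fin n, Relation.ReflTransGen D.Adj i j

/-- The standing assumption on the time-varying network, in terms of the weight matrices `A t`. -/
structure NetworkAssumption {n : ℕ} (A : ℕ → Matrix (Fin n) (Fin n) ℝ) (γ : ℝ) (B : ℕ) :
    Prop where
  /-- entries are nonnegative and every column sums to one -/
  col_stochastic : ∀ t, A t ∈ Matrix.colStochastic ℝ (Fin n)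
  /-- each node is its own in- and out-neighbour -/
  self_loop : ∀ t i, 0 < A t i i
  /-- nonzero weights are at least `γ` -/
  lower_bound : ∀ t i j, A t i j ≠ 0 → γ ≤ A t i j
  /-- the union of any `B` consecutive digraphs is strongly connected -/
  jointly_connected : ∀ t, 1 ≤ t →
    StronglyConnected (⨆ l : Fin B, inducedDigraph (A (t + l)))

/-- The scaling variables: `φ_{i,0} = 1`, `φ_{i,t+1} = ∑_j a_{ij,t} φ_{j,t}`. -/
def phi {n : ℕ} (A : ℕ → Matrix (Fin n) (Fin n) ℝ) : ℕ → Fin n → ℝ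
  | 0 => fun _ => 1
  | t + 1 => fun i => ∑ j, A t i j * phi A t j

/-- The matrix `𝓑_t` with entries `b_{ij,t} = a_{ij,t} φ_{j,t} / φ_{i,t+1}`. -/
def mix {n : ℕ} (A : ℕ → Matrix (Fin n) (Fin n) ℝ) (t : ℕ) : Matrix (Fin n) (Fin n) ℝ :=
  Matrix.of fun i j => A t i j * phi A t j / phi A (t + 1) i

/-- `mixProd A t k` is `𝓑_{t+k-1} ⋯ 𝓑_{t+1} 𝓑_t` (the identity for `k = 0`). -/
def mixProd {n : ℕ} (A : ℕ → Matrix (Fin n) (Fin n) ℝ) (t : ℕ) :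
    ℕ → Matrix (Fin n) (Fin n) ℝ
  | 0 => 1
  | k + 1 => mix A (t + k) * mixProd A t k

/-- `C`, `lam`, `θ` are admissible constants for the network: `1 / θ` bounds all scaling variables
from below, and the products of the `𝓑_t` converge to matrices with identical rows, with
geometric rate `C * lam ^ k`. -/
structure NetworkConstants {n : ℕ} (A : ℕ → Matrix (Fin n) (Fin n) ℝ) (C lam θ : ℝ) : Prop where
  C_pos : 0 < C
  lam_pos : 0 < lam
  lam_lt_one : lam < 1
  θ_pos : 0 < θ
  phi_lower : ∀ t i, θ⁻¹ ≤ phi A t i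
  mixing : ∃ π : ℕ → Fin n → ℝ, (∀ t, ∑ i, π t i = 1) ∧
    ∀ t k i j, |mixProd A t k i j - π t j| ≤ C * lam ^ k

/-! ### Constraint set and costs -/

/-- Subgradients at `x` of a function on the set `K`. -/
def subdifferentialOn {m : ℕ} (K : Set (E m)) (f : E m → ℝ) (x : E m) : Set (E m) :=
  {g | ∀ y ∈ K, f x + inner ℝ g (y - x) ≤ f y}

/-- The standing assumption on the constraint set `Ω` and the local costs `f i t`. -/
structure CostAssumption {n m : ℕ} (Ω : Set (E m)) (r R G : ℝ)
    (f : Fin n → ℕ → E m → ℝ) : Prop where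
  nonempty : Ω.Nonempty
  convex : Convex ℝ Ω
  closed : IsClosed Ω
  r_pos : 0 < r
  R_pos : 0 < R
  ball_subset : Metric.closedBall 0 r ⊆ Ω
  subset_ball : Ω ⊆ Metric.closedBall 0 R
  G_pos : 0 < G
  convex_cost : ∀ i t, ConvexOn ℝ Ω (f i t)
  bounded_subgradient : ∀ i t, ∀ x ∈ Ω, ∃ g ∈ subdifferentialOn Ω (f i t) x, ‖g‖ ≤ G

/-- The global cost `F_t = ∑_i f_{i,t}`. -/
def globalCost {n m : ℕ} (f : Fin n → ℕ → E m → ℝ) (t : ℕ) (x : E m) : ℝ :=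
  ∑ i, f i t x

/-- `xs t` minimizes the global cost `F_t` over `Ω`, for every `t`. -/
def IsMinimizerSeq {n m : ℕ} (Ω : Set (E m)) (f : Fin n → ℕ → E m → ℝ) (xs : ℕ → E m) : Prop :=
  ∀ t, xs t ∈ Ω ∧ IsMinOn (globalCost f t) Ω (xs t)

/-- The path variation `C_T = ∑_{t=0}^T ‖x*_{t+1} - x*_t‖`. -/
def pathVariation {m : ℕ} (xs : ℕ → E m) (T : ℕ) : ℝ :=
  ∑ t ∈ Finset.range (T + 1), ‖xs (t + 1) - xs t‖

/-- The dynamic regret of node `j` along a sequence of decisions `x t i`. -/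
def dynamicRegret {n m : ℕ} (f : Fin n → ℕ → E m → ℝ) (xs : ℕ → E m)
    (x : ℕ → Fin n → E m) (T : ℕ) (j : Fin n) : ℝ :=
  ∑ t ∈ Finset.range (T + 1), globalCost f t (x t j)
    - ∑ t ∈ Finset.range (T + 1), globalCost f t (xs t)

/-! ### Algorithm -/

/-- A point of `K` closest to `x`; for nonempty closed convex `K` it exists and is unique. -/
def proj {m : ℕ} (K : Set (E m)) (x : E m) : E m :=
  Classical.epsilon fun w => w ∈ K ∧ IsMinOn (fun v => ‖v - x‖ ^ 2) K w

/-- The zeroth-order oracle `(m / μ) (f (x + μ ζ) - f x) ζ`. -/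
def oracle {m : ℕ} (f : E m → ℝ) (μ : ℝ) (x ζ : E m) : E m :=
  ((m : ℝ) / μ * (f (x + μ • ζ) - f x)) • ζ

/-- The decisions `x_{i,t}` of the algorithm with smoothing `μ`, shrinkage `ξ`, step sizes `α`,
initial points `x0 i` and directions `z i t`. -/
def decisions {n m : ℕ} (A : ℕ → Matrix (Fin n) (Fin n) ℝ) (Ω : Set (E m))
    (f : Fin n → ℕ → E m → ℝ) (μ ξ : ℝ) (α : ℕ → ℝ) (x0 : Fin n → E m)
    (z : Fin n → ℕ → E m) : ℕ → Fin n → E m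
  | 0 => x0
  | t + 1 => fun i =>
      proj ((1 - ξ) • Ω)
        (∑ j, mix A t i j • decisions A Ω f μ ξ α x0 z t j
          - (1 / phi A (t + 1) i * α t) •
            oracle (f i t) μ (decisions A Ω f μ ξ α x0 z t i) (z i t))

/-- The uniform probability distribution on the unit sphere of `ℝ^m`. -/
def uniformSphere (m : ℕ) : Measure (Metric.sphere (0 : E m) 1) :=
  ((volume : Measure (E m)).toSphere Set.univ)⁻¹ • (volume : Measure (E m)).toSphere

/-- The directions `ζ_{i,t}` are independent and uniform on the unit sphere. -/
structure IsUniformNoise {S : Type*} [MeasurableSpace S] {n m : ℕ} (P : Measure S)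
    (ζ : Fin n → ℕ → S → Metric.sphere (0 : E m) 1) : Prop where
  law : ∀ i t, HasLaw (ζ i t) (uniformSphere m) P
  indep : iIndepFun (fun p : Fin n × ℕ => ζ p.1 p.2) P

/-- The smoothing parameter `μ = r / √(T+1)`. -/
def muT (r : ℝ) (T : ℕ) : ℝ := r / √((T : ℝ) + 1)

/-- The shrinkage parameter `ξ = 1 / √(T+1)`. -/
def xiT (T : ℕ) : ℝ := 1 / √((T : ℝ) + 1)

/-- The step size `α_t = 1 / (m √(t+1))`. -/
def stepSize (m t : ℕ) : ℝ := 1 / (m * √((t : ℝ) + 1))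

/-- The dynamic regret of node `j`, as a random variable, for the algorithm tuned to the
horizon `T` and started at `x0`. -/
def algRegret {S : Type*} {n m : ℕ} (A : ℕ → Matrix (Fin n) (Fin n) ℝ) (Ω : Set (E m)) (r : ℝ)
    (f : Fin n → ℕ → E m → ℝ) (xs : ℕ → E m)
    (ζ : Fin n → ℕ → S → Metric.sphere (0 : E m) 1)
    (x0 : Fin n → E m) (T : ℕ) (j : Fin n) (ω : S) : ℝ :=
  dynamicRegret f xs
    (decisions A Ω f (muT r T) (xiT T) (stepSize m) x0 fun i t => (ζ i t ω : E m)) T j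

/-- The constant `K₁`; `s` stands for `∑_i ‖x_{i,0}‖`. -/
def K₁ (n m : ℕ) (R G L C lam θ s : ℝ) : ℝ :=
  n * C * (2 * R * L * θ + 2 * m * θ * lam * G + G) / (1 - lam) * s
    + 2 * n ^ 2 * θ * C * G * R / (lam * (1 - lam))

/-- The constant `K₂`; `V` stands for the path variation `C_T`. -/
def K₂ (n m : ℕ) (r R G L C lam θ V : ℝ) : ℝ :=
  2 * n ^ 2 * θ * C * G / (1 - lam) * (2 * θ * R * L + 2 * m * θ * G + G)
    + n * m * θ ^ 2 * G ^ 2 + 2 * n * m * R ^ 2 + n * r * θ * G + n * θ * G * R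
    + 2 * n * m * R * V

end ZODOO

end

/-! By the divergence theorem, the mean of the oracle against a vector `w` is the average over the
unit ball of the derivatives of `f` in direction `w` at the points `x + μ v`. So the oracle is in
mean the gradient of a smoothed cost: against `x - u` its mean is at least `f x - f u - G μ`
(`le_integral_inner_oracle`), against any `w` at most `G ‖w‖` (`integral_inner_oracle_le`), while a
single sample has norm at most `m G`.

The weights are only column stochastic, and the energy `∑ φ_i ‖x_i - u‖²` compensates for this:
`𝓑_t` carries `φ_{t+1}` back to `φ_t`, so averaging does not increase the energy, and the factor `1
/ φ` in the step cancels the weight, so that all local costs count equally. The energy drops,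
weighted by `1 / (2 α_t)`, are summed by parts (`sum_mul_sub_le`); the comparison points `(1 - ξ)
x*_t` move, which costs the path variation, and shrinking them costs `O(ξ)` per step. Products of
the `𝓑_t` converge geometrically to matrices with equal rows (`exists_networkConstants`), so the
nodes disagree by at most a geometric convolution of the step sizes (`exists_center`). Since `∑ 1 /
√(t+1)` is `O(√(T+1))`, so is the accumulated error.

Randomness is kept apart. `dynamicRegret_add_gap_le` is an inequality for every realization; its
noise term is a sum of `oracleGap`s, whose means are nonnegative because the noise at time `t` is
independent of the decisions at time `t`. The divergence theorem needs globally Lipschitz costs,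
which an extension off `Ω` provides without changing the algorithm, as every query lies in `Ω`. The
bound is proved for `L = G / R`; the one for `L = m G / μ` is weaker. -/

namespace ZODOO

/-! ### Products of the weight matrices -/

section Network

variable {n : ℕ} {A : ℕ → Matrix (Fin n) (Fin n) ℝ} {γ : ℝ} {B : ℕ}

/-- `weightProd A t k` is the product `A_{t+k-1} ⋯ A_{t+1} A_t`. -/
def weightProd (A : ℕ → Matrix (Fin n) (Fin n) ℝ) (t : ℕ) : ℕ → Matrix (Fin n) (Fin n) ℝ
  | 0 => 1
  | k + 1 => A (t + k) * weightProd A t k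

/-- Otherwise no edge leaves `s`, and a directed path starting in `s` stays there forever. -/
lemma StronglyConnected.exists_adj_boundary {D : Digraph (Fin n)} (hD : StronglyConnected D)
    {s : Finset (Fin n)} (hs : s.Nonempty) (hs' : s ≠ Finset.univ) :
    ∃ a ∈ s, ∃ b ∉ s, D.Adj a b := by
  by_contra! h
  obtain ⟨a, ha⟩ := hs
  refine hs' (Finset.eq_univ_of_forall fun b => ?_)
  induction hD a b with
  | refl => exact ha
  | tail _ hbc ih =>
    by_contra hc
    exact h _ ih _ hc hbc

namespace NetworkAssumption

variable (hA : NetworkAssumption A γ B)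

include hA

lemma nonneg (t : ℕ) (i j : Fin n) : 0 ≤ A t i j :=
  Matrix.nonneg_of_mem_colStochastic (hA.col_stochastic t)

lemma sum_col (t : ℕ) (j : Fin n) : ∑ i, A t i j = 1 :=
  Matrix.sum_col_of_mem_colStochastic (hA.col_stochastic t) j

lemma le_self_loop (t : ℕ) (i : Fin n) : γ ≤ A t i i :=
  hA.lower_bound t i i (hA.self_loop t i).ne'

lemma weightProd_nonneg (t k : ℕ) (i j : Fin n) : 0 ≤ weightProd A t k i j := by
  induction k generalizing i with
  | zero => simp only [weightProd, Matrix.one_apply]; split_ifs <;> norm_num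
  | succ k ih =>
    rw [weightProd, Matrix.mul_apply]
    exact Finset.sum_nonneg fun l _ => mul_nonneg (hA.nonneg _ _ _) (ih l)

lemma mul_le_weightProd_succ (t k : ℕ) (i l j : Fin n) :
    A (t + k) i l * weightProd A t k l j ≤ weightProd A t (k + 1) i j :=
  Finset.single_le_sum (f := fun l => A (t + k) i l * weightProd A t k l j)
    (fun l _ => mul_nonneg (hA.nonneg _ _ _) (hA.weightProd_nonneg t k l j)) (Finset.mem_univ l)

lemma weightProd_pos_succ {t k : ℕ} {i j : Fin n} (h : 0 < weightProd A t k i j) :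
    0 < weightProd A t (k + 1) i j :=
  (mul_pos (hA.self_loop _ i) h).trans_le (hA.mul_le_weightProd_succ t k i i j)

lemma weightProd_pos_mono {t k k' : ℕ} {i j : Fin n} (hk : k ≤ k')
    (h : 0 < weightProd A t k i j) : 0 < weightProd A t k' i j := by
  induction k', hk using Nat.le_induction with
  | base => exact h
  | succ k' _ ih => exact hA.weightProd_pos_succ ih

/-- A positive entry contains a path of `k` nonzero weights, each at least `γ`. -/
lemma pow_le_weightProd (hγ : 0 < γ) {t k : ℕ} {i j : Fin n} (h : 0 < weightProd A t k i j) :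
    γ ^ k ≤ weightProd A t k i j := by
  induction k generalizing i with
  | zero =>
    simp only [weightProd, Matrix.one_apply] at h ⊢
    split_ifs at h ⊢ <;> simp_all
  | succ k ih =>
    obtain ⟨l, -, hl⟩ : ∃ l ∈ Finset.univ, 0 < A (t + k) i l * weightProd A t k l j := by
      by_contra! h'
      exact h.not_ge (Finset.sum_nonpos h')
    have hA0 : 0 < A (t + k) i l :=
      (hA.nonneg _ _ _).lt_of_ne' fun h0 => by simp [h0] at hl
    have hW0 : 0 < weightProd A t k l j := pos_of_mul_pos_right hl hA0.le
    calc γ ^ (k + 1) = γ * γ ^ k := by ring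
      _ ≤ A (t + k) i l * weightProd A t k l j :=
          mul_le_mul (hA.lower_bound _ _ _ hA0.ne') (ih hW0) (by positivity) hA0.le
      _ ≤ _ := hA.mul_le_weightProd_succ t k i l j

/-- The set of nodes reached from `j` grows by one node in every window of length `B`. -/
lemma card_reached (t q : ℕ) (j : Fin n) :
    min n (q + 1) ≤ (Finset.univ.filter fun i => 0 < weightProd A t (1 + B * q) i j).card := by
  induction q with
  | zero =>
    refine (min_le_right _ _).trans (Finset.card_pos.2 ⟨j, ?_⟩)
    simp only [Finset.mem_filter, Finset.mem_univ, true_and]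
    exact hA.weightProd_pos_mono (Nat.zero_le _) (by simp [weightProd])
  | succ q ih =>
    set s := Finset.univ.filter fun i => 0 < weightProd A t (1 + B * q) i j with hs
    set s' := Finset.univ.filter fun i => 0 < weightProd A t (1 + B * (q + 1)) i j with hs'
    have hss' : s ⊆ s' := fun i hi => by
      simp only [hs, hs', Finset.mem_filter, Finset.mem_univ, true_and] at hi ⊢
      exact hA.weightProd_pos_mono (by gcongr; omega) hi
    by_cases huniv : s = Finset.univ
    · rw [huniv, Finset.univ_subset_iff] at hss'
      simp [hss']
    have hne : s.Nonempty := ⟨j, by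
      simp only [hs, Finset.mem_filter, Finset.mem_univ, true_and]
      exact hA.weightProd_pos_mono (Nat.zero_le _) (by simp [weightProd])⟩
    obtain ⟨a, ha, b, hb, hab⟩ :=
      (hA.jointly_connected (t + (1 + B * q)) (by omega)).exists_adj_boundary hne huniv
    obtain ⟨l, hl⟩ := Digraph.iSup_adj.1 hab
    have hab' : 0 < A (t + (1 + B * q + l)) b a := by rw [← add_assoc]; exact hl
    have ha' : 0 < weightProd A t (1 + B * q) a j := by simpa [hs] using ha
    have hb' : b ∈ s' := by
      simp only [hs', Finset.mem_filter, Finset.mem_univ, true_and]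
      -- Self-loops keep `a` reached until the edge to `b` appears, `l < B` steps into the window;
      -- `b` is reached one step later, still within the window, and stays reached.
      refine hA.weightProd_pos_mono (k := 1 + B * q + l + 1) ?_
        ((mul_pos hab' (hA.weightProd_pos_mono (Nat.le_add_right _ _) ha')).trans_le
          (hA.mul_le_weightProd_succ t (1 + B * q + l) b a j))
      have := l.2
      rw [mul_add]
      omega
    have : s.card < s'.card := Finset.card_lt_card
      ⟨hss', fun h => hb (h hb')⟩
    omega

/-- The leading `1` in the exponent skips time `0`, where joint connectivity is not assumed; after
`n` further windows all `n` nodes are reached. -/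
lemma pow_le_weightProd_window (hγ : 0 < γ) (t : ℕ) (i j : Fin n) :
    γ ^ (1 + B * n) ≤ weightProd A t (1 + B * n) i j := by
  refine hA.pow_le_weightProd hγ ?_
  have h := hA.card_reached t n j
  rw [min_eq_left (Nat.le_succ n)] at h
  have h' := Finset.eq_univ_of_card (Finset.univ.filter fun i => 0 < weightProd A t (1 + B * n) i j)
    (le_antisymm (Finset.card_le_univ _) (by simpa using h))
  have := Finset.mem_univ i
  rw [← h'] at this
  simpa using this

/-! ### Mass conservation and lower bounds for the scaling variables -/

lemma sum_phi (t : ℕ) : ∑ i, phi A t i = n := by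
  induction t with
  | zero => simp [phi]
  | succ t ih =>
    simp only [phi]
    rw [Finset.sum_comm, ← ih]
    refine Finset.sum_congr rfl fun j _ => ?_
    rw [← Finset.sum_mul, hA.sum_col, one_mul]

omit hA in
lemma phi_add (t k : ℕ) (i : Fin n) :
    phi A (t + k) i = ∑ j, weightProd A t k i j * phi A t j := by
  induction k generalizing i with
  | zero => simp [weightProd, Matrix.one_apply]
  | succ k ih =>
    rw [← add_assoc]
    simp only [phi, weightProd, Matrix.mul_apply, ih, Finset.mul_sum, Finset.sum_mul]
    rw [Finset.sum_comm]
    exact Finset.sum_congr rfl fun _ _ => Finset.sum_congr rfl fun _ _ => by ring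

lemma pow_le_phi (hγ : 0 < γ) (t : ℕ) (i : Fin n) : γ ^ t ≤ phi A t i := by
  induction t generalizing i with
  | zero => simp [phi]
  | succ t ih =>
    calc γ ^ (t + 1) = γ * γ ^ t := by ring
      _ ≤ A t i i * phi A t i :=
          mul_le_mul (hA.le_self_loop t i) (ih i) (by positivity) (hA.self_loop t i).le
      _ ≤ _ := Finset.single_le_sum (f := fun j => A t i j * phi A t j)
          (fun j _ => mul_nonneg (hA.nonneg _ _ _) ((by positivity : (0 : ℝ) ≤ γ ^ t).trans (ih j)))
          (Finset.mem_univ i)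

lemma phi_pos (hγ : 0 < γ) (t : ℕ) (i : Fin n) : 0 < phi A t i :=
  (pow_pos hγ t).trans_le (hA.pow_le_phi hγ t i)

lemma phi_le (hγ : 0 < γ) (t : ℕ) (i : Fin n) : phi A t i ≤ n := by
  rw [← hA.sum_phi t]
  exact Finset.single_le_sum (fun j _ => (hA.phi_pos hγ t j).le) (Finset.mem_univ i)

/-- Before one full window has passed, self-loops alone give `γ ^ t`. Later, a full window spreads
the conserved total mass `n ≥ 1` to every node. -/
lemma pow_window_le_phi (hγ : 0 < γ) (hγ1 : γ < 1) (t : ℕ) (i : Fin n) :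
    γ ^ (1 + B * n) ≤ phi A t i := by
  rcases le_total t (1 + B * n) with ht | ht
  · exact (pow_le_pow_of_le_one hγ.le hγ1.le ht).trans (hA.pow_le_phi hγ t i)
  · obtain ⟨s, rfl⟩ := Nat.exists_eq_add_of_le' ht
    rw [phi_add]
    have h1 : (1 : ℝ) ≤ ∑ j, phi A s j := by
      rw [hA.sum_phi]
      exact_mod_cast (Fin.pos i)
    calc γ ^ (1 + B * n) ≤ γ ^ (1 + B * n) * ∑ j, phi A s j :=
          le_mul_of_one_le_right (by positivity) h1
      _ ≤ _ := by
        rw [Finset.mul_sum]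
        exact Finset.sum_le_sum fun j _ => mul_le_mul_of_nonneg_right
          (hA.pow_le_weightProd_window hγ s i j) (hA.phi_pos hγ s j).le

/-! ### The row-stochastic matrices `𝓑_t` -/

lemma mix_nonneg (hγ : 0 < γ) (t : ℕ) (i j : Fin n) : 0 ≤ mix A t i j :=
  div_nonneg (mul_nonneg (hA.nonneg _ _ _) (hA.phi_pos hγ _ _).le) (hA.phi_pos hγ _ _).le

lemma sum_mix (hγ : 0 < γ) (t : ℕ) (i : Fin n) : ∑ j, mix A t i j = 1 := by
  simp only [mix, Matrix.of_apply]
  rw [← Finset.sum_div]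
  exact div_self (hA.phi_pos hγ (t + 1) i).ne'

lemma mix_mem (hγ : 0 < γ) (t : ℕ) : mix A t ∈ Matrix.rowStochastic ℝ (Fin n) :=
  Matrix.mem_rowStochastic_iff_sum.2 ⟨hA.mix_nonneg hγ t, hA.sum_mix hγ t⟩

/-- The scaling variables are transported backwards by `𝓑_t`. -/
lemma sum_phi_mul_mix (hγ : 0 < γ) (t : ℕ) (j : Fin n) :
    ∑ i, phi A (t + 1) i * mix A t i j = phi A t j := by
  simp only [mix, Matrix.of_apply]
  rw [Finset.sum_congr rfl fun i _ => mul_div_cancel₀ (A t i j * phi A t j)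
    (hA.phi_pos hγ (t + 1) i).ne', ← Finset.sum_mul, hA.sum_col, one_mul]

lemma mixProd_mem (hγ : 0 < γ) (t k : ℕ) : mixProd A t k ∈ Matrix.rowStochastic ℝ (Fin n) := by
  induction k with
  | zero => exact one_mem _
  | succ k ih => exact mul_mem (hA.mix_mem hγ _) ih

omit hA in
lemma mixProd_add (t k l : ℕ) :
    mixProd A t (k + l) = mixProd A (t + k) l * mixProd A t k := by
  induction l with
  | zero => simp [mixProd]
  | succ l ih => rw [← add_assoc, mixProd, ih, mixProd, Matrix.mul_assoc, add_assoc]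

/-- The `𝓑` products are the `A` products conjugated by the diagonal matrices of scaling variables,
so bounds on entries pass from one to the other. -/
lemma mixProd_mul_phi (hγ : 0 < γ) (t k : ℕ) (i j : Fin n) :
    mixProd A t k i j * phi A (t + k) i = weightProd A t k i j * phi A t j := by
  induction k generalizing i with
  | zero =>
    simp only [mixProd, weightProd, Matrix.one_apply]
    split_ifs with h <;> simp [h]
  | succ k ih =>
    simp only [mixProd, weightProd, Matrix.mul_apply, Finset.sum_mul]
    refine Finset.sum_congr rfl fun l _ => ?_
    rw [mul_assoc (A (t + k) i l), ← ih l]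
    simp only [mix, Matrix.of_apply, ← add_assoc]
    have := (hA.phi_pos hγ (t + k + 1) i).ne'
    field_simp

lemma le_mixProd_window (hγ : 0 < γ) (hγ1 : γ < 1) (t : ℕ) (i j : Fin n) :
    (γ ^ (1 + B * n)) ^ 2 / n ≤ mixProd A t (1 + B * n) i j := by
  have hn : (0 : ℝ) < n := by exact_mod_cast Fin.pos i
  have hM := (hA.mixProd_mem hγ t (1 + B * n)).1 i j
  rw [div_le_iff₀ hn]
  calc (γ ^ (1 + B * n)) ^ 2 = γ ^ (1 + B * n) * γ ^ (1 + B * n) := by ring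
    _ ≤ weightProd A t (1 + B * n) i j * phi A t j :=
        mul_le_mul (hA.pow_le_weightProd_window hγ t i j) (hA.pow_window_le_phi hγ hγ1 t j)
          (by positivity) (hA.weightProd_nonneg _ _ _ _)
    _ = mixProd A t (1 + B * n) i j * phi A (t + (1 + B * n)) i :=
        (hA.mixProd_mul_phi hγ t _ i j).symm
    _ ≤ _ := mul_le_mul_of_nonneg_left (hA.phi_le hγ _ _) hM

end NetworkAssumption

/-! ### Averaging contracts oscillation -/

/-- If all entries of `v` lie in `[a, b]`, so do those of `M v` for row-stochastic `M`; and
they lie in a shorter interval if the entries of `M` are bounded below. -/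
lemma exists_mulVec_mem_Icc {M : Matrix (Fin n) (Fin n) ℝ}
    (hM : M ∈ Matrix.rowStochastic ℝ (Fin n)) {η : ℝ} (hη : 0 ≤ η) (hMη : ∀ i j, η ≤ M i j)
    {v : Fin n → ℝ} {a b : ℝ} (hv : ∀ i, v i ∈ Set.Icc a b) (hη1 : η ≤ 1) (hab : a ≤ b) :
    ∃ a' b', a ≤ a' ∧ a' ≤ b' ∧ b' ≤ b ∧ b' - a' ≤ (1 - η) * (b - a) ∧
      ∀ i, M.mulVec v i ∈ Set.Icc a' b' := by
  rcases isEmpty_or_nonempty (Fin n) with hn | ⟨⟨k⟩⟩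
  · exact ⟨a, a, le_rfl, le_rfl, hab, by
      rw [sub_self]; exact mul_nonneg (by linarith) (by linarith), fun i => hn.elim i⟩
  have hrow := Matrix.sum_row_of_mem_rowStochastic hM
  -- Every row puts weight at least `η` on one fixed coordinate `k`. This pulls both ends towards `v
  -- k`, by amounts that add up to `η * (b - a)` wherever `v k` lies.
  refine ⟨a + η * (v k - a), b - η * (b - v k), ?_, ?_, ?_, by linarith, fun i => ⟨?_, ?_⟩⟩
  · nlinarith [(hv k).1]
  · nlinarith
  · nlinarith [(hv k).2]
  · have : ∑ j, M i j * (v j - a) = M.mulVec v i - a := by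
      simp only [mul_sub, Finset.sum_sub_distrib, ← Finset.sum_mul, hrow, one_mul]
      rfl
    have h2 : M i k * (v k - a) ≤ ∑ j, M i j * (v j - a) :=
      Finset.single_le_sum (f := fun j => M i j * (v j - a))
        (fun j _ => mul_nonneg (hM.1 i j) (by linarith [(hv j).1])) (Finset.mem_univ k)
    have h3 : η * (v k - a) ≤ M i k * (v k - a) :=
      mul_le_mul_of_nonneg_right (hMη i k) (by linarith [(hv k).1])
    linarith
  · have : ∑ j, M i j * (b - v j) = b - M.mulVec v i := by
      simp only [mul_sub, Finset.sum_sub_distrib, ← Finset.sum_mul, hrow, one_mul]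
      rfl
    have h2 : M i k * (b - v k) ≤ ∑ j, M i j * (b - v j) :=
      Finset.single_le_sum (f := fun j => M i j * (b - v j))
        (fun j _ => mul_nonneg (hM.1 i j) (by linarith [(hv j).2])) (Finset.mem_univ k)
    have h3 : η * (b - v k) ≤ M i k * (b - v k) :=
      mul_le_mul_of_nonneg_right (hMη i k) (by linarith [(hv k).2])
    linarith

/-- Each full window shrinks the range of a column by `1 - η`. The interval also holds at all later
times, since further averaging (the case `η = 0`) cannot leave it; this makes limits comparable. -/
lemma NetworkAssumption.mixProd_osc (hA : NetworkAssumption A γ B) (hγ : 0 < γ)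
    {η : ℝ} (hη : 0 ≤ η) (hη1 : η ≤ 1) (hle : ∀ t i j, η ≤ mixProd A t (1 + B * n) i j)
    (t q : ℕ) (j : Fin n) :
    ∃ a b, a ≤ b ∧ b - a ≤ (1 - η) ^ q ∧
      ∀ k, (1 + B * n) * q ≤ k → ∀ i, mixProd A t k i j ∈ Set.Icc a b := by
  have key : ∃ a b, a ≤ b ∧ b - a ≤ (1 - η) ^ q ∧
      ∀ i, mixProd A t ((1 + B * n) * q) i j ∈ Set.Icc a b := by
    induction q with
    | zero =>
      refine ⟨0, 1, zero_le_one, by simp, fun i => ?_⟩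
      have h := hA.mixProd_mem hγ t ((1 + B * n) * 0)
      exact ⟨h.1 i j, Matrix.le_one_of_mem_rowStochastic h⟩
    | succ q ih =>
      obtain ⟨a, b, hab, hq, h⟩ := ih
      obtain ⟨a', b', -, h2, -, h4, h5⟩ := exists_mulVec_mem_Icc
        (hA.mixProd_mem hγ (t + (1 + B * n) * q) (1 + B * n)) hη
        (hle (t + (1 + B * n) * q)) h hη1 hab
      refine ⟨a', b', h2, h4.trans ?_, fun i => ?_⟩
      · rw [pow_succ']
        exact mul_le_mul_of_nonneg_left hq (by linarith)
      · rw [mul_add_one, NetworkAssumption.mixProd_add]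
        exact h5 i
  obtain ⟨a, b, hab, hq, h⟩ := key
  refine ⟨a, b, hab, hq, fun k hk i => ?_⟩
  obtain ⟨l, rfl⟩ := Nat.exists_eq_add_of_le hk
  obtain ⟨a', b', h1, h2, h3, h4, h5⟩ := exists_mulVec_mem_Icc
    (hA.mixProd_mem hγ (t + (1 + B * n) * q) l) le_rfl
    (fun i j => (hA.mixProd_mem hγ (t + (1 + B * n) * q) l).1 i j) h zero_le_one hab
  rw [NetworkAssumption.mixProd_add]
  exact ⟨h1.trans (h5 i).1, (h5 i).2.trans h3⟩

/-- Admissible constants exist and depend on the network only through `n`, `γ`, `B`. -/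
theorem exists_networkConstants (n B : ℕ) (hn : 1 ≤ n) {γ : ℝ} (hγ : 0 < γ) (hγ1 : γ < 1) :
    ∃ C lam θ : ℝ, ∀ A : ℕ → Matrix (Fin n) (Fin n) ℝ,
      NetworkAssumption A γ B → NetworkConstants A C lam θ := by
  set N := 1 + B * n with hN
  have hN1 : (1 : ℝ) ≤ N := by rw [hN]; push_cast; nlinarith [(by positivity : (0 : ℝ) ≤ B * n)]
  have hn1 : (1 : ℝ) ≤ n := by exact_mod_cast hn
  set η := (γ ^ N) ^ 2 / n with hη
  have hη0 : 0 < η := by positivity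
  have hγN : γ ^ N < 1 := pow_lt_one₀ hγ.le hγ1 (by omega)
  have hη1 : η < 1 := by
    rw [hη, div_lt_one (by linarith)]
    exact (pow_lt_one₀ (by positivity) hγN (by norm_num)).trans_le hn1
  -- Chosen so that Bernoulli's inequality gives `1 - η ≤ lam ^ N`: one window contracts at least as
  -- much as `N` steps at rate `lam`.
  set lam := 1 - η / N with hlam
  have hηN : η / N ≤ η := div_le_self hη0.le hN1
  have hlam0 : 0 < lam := by linarith
  have hlam1 : lam < 1 := by
    have : 0 < η / N := by positivity
    linarith
  have hbern : 1 - η ≤ lam ^ N := by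
    have := one_add_mul_le_pow (a := -(η / N)) (by linarith) N
    rw [hlam, sub_eq_add_neg 1 (η / N)]
    refine le_trans (le_of_eq ?_) this
    field_simp
    ring
  -- The factor `(lam ^ N)⁻¹` pays for rounding `k` down to a whole number of windows.
  refine ⟨(lam ^ N)⁻¹, lam, (γ ^ N)⁻¹, fun A hA => ?_⟩
  have hosc := hA.mixProd_osc hγ hη0.le hη1.le (hA.le_mixProd_window hγ hγ1)
  -- Two rows and two times are compared at once: fixing the row gives a Cauchy sequence in time,
  -- fixing the time shows that all rows share one limit.
  have hrate : ∀ t k k' (i i' j : Fin n), k ≤ k' →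
      |mixProd A t k i j - mixProd A t k' i' j| ≤ (lam ^ N)⁻¹ * lam ^ k := by
    intro t k k' i i' j hk
    obtain ⟨a, b, hab, hq, h⟩ := hosc t (k / N) j
    have h1 := h k (Nat.mul_div_le k N) i
    have h2 := h k' ((Nat.mul_div_le k N).trans hk) i'
    calc |mixProd A t k i j - mixProd A t k' i' j| ≤ b - a :=
          abs_sub_le_of_le_of_le h1.1 h1.2 h2.1 h2.2
      _ ≤ (1 - η) ^ (k / N) := hq
      _ ≤ (lam ^ N) ^ (k / N) := pow_le_pow_left₀ (by linarith) hbern _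
      _ ≤ (lam ^ N)⁻¹ * lam ^ k := by
        rw [← pow_mul, inv_mul_eq_div, le_div_iff₀ (by positivity), ← pow_add]
        refine pow_le_pow_of_le_one hlam0.le hlam1.le ?_
        have := Nat.div_add_mod k N
        have := Nat.mod_lt k (by omega : 0 < N)
        omega
  have hlim : ∀ t j, ∃ p, ∀ i, Tendsto (fun k => mixProd A t k i j) atTop (nhds p) := by
    intro t j
    have hz : Tendsto (fun k => (lam ^ N)⁻¹ * lam ^ k) atTop (nhds 0) := by
      simpa using (tendsto_pow_atTop_nhds_zero_of_lt_one hlam0.le hlam1).const_mul ((lam ^ N)⁻¹)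
    have hcau : CauchySeq fun k => mixProd A t k ⟨0, hn⟩ j :=
      cauchySeq_of_le_tendsto_0' (fun k => (lam ^ N)⁻¹ * lam ^ k)
        (fun k k' hk => hrate t k k' _ _ j hk) hz
    obtain ⟨p, hp⟩ := cauchySeq_tendsto_of_complete hcau
    refine ⟨p, fun i => ?_⟩
    have hd : Tendsto (fun k => mixProd A t k i j - mixProd A t k ⟨0, hn⟩ j) atTop (nhds 0) :=
      squeeze_zero_norm (fun k => hrate t k k i _ j le_rfl) hz
    simpa using hd.add hp
  choose π hπ using hlim
  refine ⟨by positivity, hlam0, hlam1, by positivity, fun t i => ?_, π, fun t => ?_, ?_⟩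
  · rw [inv_inv]
    exact hA.pow_window_le_phi hγ hγ1 t i
  · have h1 := tendsto_finsetSum Finset.univ fun j _ => hπ t j ⟨0, hn⟩
    simp only [Matrix.sum_row_of_mem_rowStochastic (hA.mixProd_mem hγ t _)] at h1
    exact tendsto_nhds_unique h1 tendsto_const_nhds
  · intro t k i j
    have h1 : Tendsto (fun k' => |mixProd A t k i j - mixProd A t k' i j|) atTop
        (nhds |mixProd A t k i j - π t j|) := ((hπ t j i).const_sub _).abs
    refine le_of_tendsto h1 ?_
    filter_upwards [eventually_ge_atTop k] with k' hk'
    exact hrate t k k' i i j hk'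

end Network

/-! ### The uniform distribution on the sphere and the divergence theorem on the ball -/

section Sphere

open Metric

variable {m : ℕ}

lemma nontrivial_E (hm : 1 ≤ m) : Nontrivial (E m) := by
  have : Nonempty (Fin m) := ⟨⟨0, hm⟩⟩
  infer_instance

lemma isProbabilityMeasure_uniformSphere (hm : 1 ≤ m) :
    IsProbabilityMeasure (uniformSphere m) := by
  have := nontrivial_E hm
  refine ⟨?_⟩
  rw [uniformSphere, Measure.smul_apply, smul_eq_mul]
  exact ENNReal.inv_mul_cancel (Measure.measure_univ_ne_zero.2 (Measure.toSphere_ne_zero _))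
    (measure_ne_top _ _)

/-- Integration in polar coordinates of a product of a radial and a spherical function. -/
lemma integral_direction_mul_norm (hm : 1 ≤ m) (q : E m → ℝ) (p : ℝ → ℝ) :
    ∫ x : E m, q (‖x‖⁻¹ • x) * p ‖x‖
      = (∫ ζ, q (ζ : E m) ∂uniformSphere m) * ∫ x : E m, p ‖x‖ := by
  have := nontrivial_E hm
  set σ := (volume : Measure (E m)).toSphere with hσ
  set ν := Measure.volumeIoiPow (Module.finrank ℝ (E m) - 1) with hν
  have key : ∀ q : E m → ℝ, ∫ x : E m, q (‖x‖⁻¹ • x) * p ‖x‖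
      = (∫ ζ, q (ζ : E m) ∂σ) * ∫ s : Set.Ioi (0 : ℝ), p s ∂ν := by
    intro q
    calc ∫ x : E m, q (‖x‖⁻¹ • x) * p ‖x‖
        = ∫ x : ({0}ᶜ : Set (E m)), q (‖x.1‖⁻¹ • x.1) * p ‖x.1‖
            ∂((volume : Measure (E m)).comap (↑)) := by
          rw [integral_subtype_comap (measurableSet_singleton _).compl
            fun x : E m => q (‖x‖⁻¹ • x) * p ‖x‖, restrict_compl_singleton]
      _ = ∫ z : sphere (0 : E m) 1 × Set.Ioi (0 : ℝ), q (z.1 : E m) * p z.2 ∂(σ.prod ν) := by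
          rw [←
            (volume : Measure (E m)).measurePreserving_homeomorphUnitSphereProd.integral_comp
            (Homeomorph.measurableEmbedding _)
            (fun z : sphere (0 : E m) 1 × Set.Ioi (0 : ℝ) => q (z.1 : E m) * p z.2)]
          simp only [homeomorphUnitSphereProd_apply_fst_coe, homeomorphUnitSphereProd_apply_snd_coe]
      _ = _ := integral_prod_mul (fun ζ : sphere (0 : E m) 1 => q (ζ : E m))
          (fun s : Set.Ioi (0 : ℝ) => p s)
  -- The constant spherical function identifies the radial factor as `∫ p ‖x‖` divided by the total
  -- surface measure, which is the normalization in `uniformSphere`.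
  have h1 := key fun _ => 1
  simp only [one_mul, integral_const, smul_eq_mul, mul_one] at h1
  rw [key, h1, uniformSphere, integral_smul_measure, smul_eq_mul, ENNReal.toReal_inv, ← hσ]
  have : σ.real Set.univ ≠ 0 := by
    rw [Measure.real, ENNReal.toReal_ne_zero]
    exact ⟨Measure.measure_univ_ne_zero.2 (Measure.toSphere_ne_zero _), measure_ne_top _ _⟩
  rw [← Measure.real]
  field_simp

/-- The radial cutoff function, one on the ball of radius `1 - δ`, zero off the unit ball. -/
noncomputable def cutoff (δ : ℝ) (v : E m) : ℝ := min 1 (max ((1 - ‖v‖) / δ) 0)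

lemma lipschitzWith_cutoff {δ : ℝ} (hδ : 0 < δ) :
    LipschitzWith (Real.toNNReal δ⁻¹) (cutoff (m := m) δ) := by
  refine (LipschitzWith.max_const (LipschitzWith.of_dist_le_mul fun x y => ?_) 0).const_min 1
  rw [Real.coe_toNNReal _ (by positivity), Real.dist_eq, ← sub_div, div_eq_inv_mul, abs_mul,
    abs_of_pos (inv_pos.2 hδ), dist_eq_norm]
  gcongr
  rw [show 1 - ‖x‖ - (1 - ‖y‖) = ‖y‖ - ‖x‖ by ring, norm_sub_rev]
  exact abs_norm_sub_norm_le y x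

lemma cutoff_nonneg {δ : ℝ} (v : E m) : 0 ≤ cutoff δ v :=
  le_min zero_le_one (le_max_right _ _)

lemma cutoff_le_one {δ : ℝ} (v : E m) : cutoff δ v ≤ 1 := min_le_left _ _

lemma cutoff_of_norm_le {δ : ℝ} (hδ : 0 < δ) {v : E m} (hv : ‖v‖ ≤ 1 - δ) : cutoff δ v = 1 :=
  min_eq_left (le_max_of_le_left ((one_le_div hδ).2 (by linarith)))

lemma cutoff_of_le_norm {δ : ℝ} (hδ : 0 < δ) {v : E m} (hv : 1 ≤ ‖v‖) : cutoff δ v = 0 := by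
  rw [cutoff, max_eq_right (div_nonpos_of_nonpos_of_nonneg (by linarith) hδ.le)]
  simp

lemma hasCompactSupport_cutoff {δ : ℝ} (hδ : 0 < δ) : HasCompactSupport (cutoff (m := m) δ) :=
  HasCompactSupport.of_support_subset_isCompact (isCompact_closedBall 0 1) fun v hv => by
    rw [mem_closedBall_zero_iff]
    by_contra! h
    exact hv (cutoff_of_le_norm hδ h.le)

lemma hasLineDerivAt_norm {v : E m} (hv : v ≠ 0) (w : E m) :
    HasLineDerivAt ℝ (fun x : E m => ‖x‖) (inner ℝ (‖v‖⁻¹ • v) w) v w := by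
  have h1 : HasDerivAt (fun t : ℝ => v + t • w) w 0 := by
    simpa using ((hasDerivAt_id (0 : ℝ)).smul_const w).const_add v
  have h2 := h1.norm_sq.sqrt (by simpa using hv)
  simp only [Real.sqrt_sq (norm_nonneg _), zero_smul, add_zero] at h2
  have h3 : 2 * inner ℝ v w / (2 * ‖v‖) = inner ℝ (‖v‖⁻¹ • v) w := by
    rw [real_inner_smul_left]
    have := norm_ne_zero_iff.2 hv
    field_simp
  rwa [h3] at h2

/-- The direction `-w` is the one that integration by parts produces. The two excluded spheres,
where the cutoff has kinks, are null sets. -/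
lemma lineDeriv_cutoff {δ : ℝ} (hδ : 0 < δ) (hδ1 : δ < 1) (w : E m) {v : E m} (h1 : ‖v‖ ≠ 1)
    (h2 : ‖v‖ ≠ 1 - δ) : lineDeriv ℝ (cutoff δ) v (-w)
      = (Set.Ioo (1 - δ) 1).indicator (fun _ => δ⁻¹) ‖v‖ * inner ℝ (‖v‖⁻¹ • v) w := by
  rcases lt_or_gt_of_ne h2 with h2 | h2
  · rw [Set.indicator_of_notMem (by simp [h2.le]), zero_mul]
    have : cutoff δ =ᶠ[nhds v] fun _ => (1 : ℝ) := by
      filter_upwards [continuous_norm.continuousAt.eventually_lt continuousAt_const h2] with y hy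
      exact cutoff_of_norm_le hδ hy.le
    rw [this.lineDeriv_eq, lineDeriv, deriv_const]
  rcases lt_or_gt_of_ne h1 with h1 | h1
  · rw [Set.indicator_of_mem (Set.mem_Ioo.2 ⟨h2, h1⟩)]
    have hv : v ≠ 0 := norm_ne_zero_iff.1 (by linarith)
    have : cutoff δ =ᶠ[nhds v] fun y => δ⁻¹ * (1 - ‖y‖) := by
      filter_upwards [continuous_norm.continuousAt.eventually_lt continuousAt_const h1,
        continuousAt_const.eventually_lt continuous_norm.continuousAt h2] with y hy1 hy2
      rw [cutoff, max_eq_left (div_nonneg (by linarith) hδ.le), min_eq_right, div_eq_inv_mul]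
      rw [div_le_one hδ]
      linarith
    have h3 : lineDeriv ℝ (fun y : E m => δ⁻¹ * (1 - ‖y‖)) v (-w)
        = δ⁻¹ * -inner ℝ (‖v‖⁻¹ • v) (-w) :=
      (((hasLineDerivAt_norm hv (-w)).const_sub 1).const_mul δ⁻¹).deriv
    rw [this.lineDeriv_eq, h3, inner_neg_right, neg_neg]
  · rw [Set.indicator_of_notMem (by simp [h1.le]), zero_mul]
    have : cutoff δ =ᶠ[nhds v] fun _ => (0 : ℝ) := by
      filter_upwards [continuousAt_const.eventually_lt continuous_norm.continuousAt h1] with y hy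
      exact cutoff_of_le_norm hδ hy.le
    rw [this.lineDeriv_eq, lineDeriv, deriv_const]

/-- The volume of a thin shell inside the unit sphere. -/
lemma integral_shell {δ : ℝ} (hδ : 0 < δ) (hδ1 : δ < 1) :
    ∫ v : E m, (Set.Ioo (1 - δ) 1).indicator (fun _ => (1 : ℝ)) ‖v‖
      = (volume : Measure (E m)).real (ball 0 1) * (1 - (1 - δ) ^ m) := by
  have h : (fun v : E m => (Set.Ioo (1 - δ) 1).indicator (fun _ => (1 : ℝ)) ‖v‖)
      = (ball (0 : E m) 1 \ closedBall 0 (1 - δ)).indicator fun _ => 1 := by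
    funext v
    simp only [Set.indicator, Set.mem_Ioo, Set.mem_sdiff, mem_ball_zero_iff,
      mem_closedBall_zero_iff, not_le, and_comm]
  rw [h, integral_indicator (measurableSet_ball.diff measurableSet_closedBall), setIntegral_const,
    smul_eq_mul, mul_one, measureReal_sdiff (closedBall_subset_ball (by linarith))
    measurableSet_closedBall, Measure.real, Measure.real,
    Measure.addHaar_closedBall _ _ (by linarith : (0 : ℝ) ≤ 1 - δ), ENNReal.toReal_mul,
    ENNReal.toReal_ofReal (by have : 0 ≤ 1 - δ := by linarith
                              positivity)]
  simp only [finrank_euclideanSpace, Fintype.card_fin]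
  ring

lemma integrable_of_le_ball {F : E m → ℝ} (hF : AEStronglyMeasurable F volume) {c : ℝ}
    (h : ∀ᵐ v, ‖F v‖ ≤ (ball (0 : E m) 1).indicator (fun _ => c) v) : Integrable F :=
  Integrable.mono' ((integrable_indicator_iff measurableSet_ball).2
    (integrableOn_const measure_ball_lt_top.ne)) hF h

lemma integrable_shell (δ : ℝ) :
    Integrable fun v : E m => (Set.Ioo (1 - δ) 1).indicator (fun _ => (1 : ℝ)) ‖v‖ := by
  refine integrable_of_le_ball (c := 1) ?_ (ae_of_all _ fun v => ?_)
  · exact ((measurable_const.indicator measurableSet_Ioo).comp measurable_norm).aestronglyMeasurable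
  · by_cases hv : ‖v‖ < 1
    · rw [Set.indicator_of_mem (mem_ball_zero_iff.2 hv)]
      by_cases h : ‖v‖ ∈ Set.Ioo (1 - δ) 1 <;> simp [h]
    · rw [Set.indicator_of_notMem (by simp [hv]), Set.indicator_of_notMem (by simpa using hv)]
      simp

/-- A quantitative form of the divergence theorem, obtained by cutting off in a thin shell. -/
lemma abs_integral_lineDeriv_sub_le (hm : 1 ≤ m) {h : E m → ℝ} {K : NNReal}
    (hh : LipschitzWith K h) (w : E m) {δ : ℝ} (hδ : 0 < δ) (hδ1 : δ < 1) :
    |(∫ v in ball (0 : E m) 1, lineDeriv ℝ h v w)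
        - (∫ ζ, inner ℝ (ζ : E m) w * h ζ ∂uniformSphere m)
          * (δ⁻¹ * ((volume : Measure (E m)).real (ball 0 1) * (1 - (1 - δ) ^ m)))|
      ≤ 2 * K * ‖w‖ * ((volume : Measure (E m)).real (ball 0 1) * (1 - (1 - δ) ^ m)) := by
  have := nontrivial_E hm
  set S : E m → ℝ := fun v => (Set.Ioo (1 - δ) 1).indicator (fun _ => (1 : ℝ)) ‖v‖ with hS
  have hSint : Integrable S := integrable_shell δ
  have hSm : Measurable S := (measurable_const.indicator measurableSet_Ioo).comp measurable_norm
  have hSv : ∀ v, S v = 1 ∧ 1 - δ < ‖v‖ ∧ ‖v‖ < 1 ∨ S v = 0 ∧ (‖v‖ ≤ 1 - δ ∨ 1 ≤ ‖v‖) := by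
    intro v
    by_cases hv : ‖v‖ ∈ Set.Ioo (1 - δ) 1
    · exact Or.inl ⟨by simp only [hS, Set.indicator_of_mem hv], hv⟩
    · refine Or.inr ⟨by simp only [hS, Set.indicator_of_notMem hv], ?_⟩
      by_contra! h
      exact hv h
  have hbd : ∀ v, ‖lineDeriv ℝ h v w‖ ≤ K * ‖w‖ := fun v => norm_lineDeriv_le_of_lipschitz ℝ hh
  have hLm : Measurable fun v => lineDeriv ℝ h v w := measurable_lineDeriv hh.continuous
  have hcm : Measurable (cutoff (m := m) δ) := (lipschitzWith_cutoff hδ).continuous.measurable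
  rw [← integral_shell hδ hδ1]
  -- the cutoff changes the bulk integral only in the shell
  have h1 : |(∫ v in ball (0 : E m) 1, lineDeriv ℝ h v w) - ∫ v, lineDeriv ℝ h v w * cutoff δ v|
      ≤ K * ‖w‖ * ∫ v, S v := by
    rw [← integral_indicator measurableSet_ball, ← integral_sub, ← integral_const_mul]
    · rw [← Real.norm_eq_abs]
      refine norm_integral_le_of_norm_le (hSint.const_mul _) (ae_of_all _ fun v => ?_)
      by_cases hvb : ‖v‖ < 1
      · rw [Set.indicator_of_mem (mem_ball_zero_iff.2 hvb)]
        rcases hSv v with ⟨hs, -⟩ | ⟨hs, hs' | hs'⟩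
        · rw [hs, mul_one, ← mul_one_sub, norm_mul]
          refine (mul_le_of_le_one_right (norm_nonneg _) ?_).trans (hbd v)
          rw [Real.norm_eq_abs, abs_of_nonneg (by linarith [cutoff_le_one (δ := δ) v])]
          linarith [cutoff_nonneg (δ := δ) v]
        · rw [hs, cutoff_of_norm_le hδ hs']; simp
        · linarith
      · rw [Set.indicator_of_notMem (by simpa using hvb), cutoff_of_le_norm hδ (not_lt.1 hvb)]
        simp only [mul_zero, sub_zero, norm_zero]
        rcases hSv v with ⟨hs, -⟩ | ⟨hs, -⟩ <;> rw [hs] <;> positivity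
    · refine integrable_of_le_ball (c := K * ‖w‖)
        (hLm.indicator measurableSet_ball).aestronglyMeasurable (ae_of_all _ fun v => ?_)
      by_cases hvb : v ∈ ball (0 : E m) 1
      · simpa only [Set.indicator_of_mem hvb] using hbd v
      · simp only [Set.indicator_of_notMem hvb, norm_zero, le_refl]
    · refine integrable_of_le_ball (c := K * ‖w‖)
        (hLm.mul hcm).aestronglyMeasurable (ae_of_all _ fun v => ?_)
      by_cases hvb : v ∈ ball (0 : E m) 1
      · rw [Set.indicator_of_mem hvb, norm_mul]
        refine (mul_le_of_le_one_right (norm_nonneg _) ?_).trans (hbd v)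
        rw [Real.norm_eq_abs, abs_of_nonneg (cutoff_nonneg v)]
        exact cutoff_le_one v
      · rw [Set.indicator_of_notMem hvb, cutoff_of_le_norm hδ (by simpa using hvb)]
        simp
  have h2 : ∫ v, lineDeriv ℝ h v w * cutoff δ v
      = ∫ v, δ⁻¹ * S v * inner ℝ (‖v‖⁻¹ • v) w * h v := by
    rw [hh.integral_lineDeriv_mul_eq (lipschitzWith_cutoff hδ) (hasCompactSupport_cutoff hδ) w]
    refine integral_congr_ae ?_
    have n1 : ∀ᵐ v : E m, v ∉ sphere (0 : E m) 1 :=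
      measure_eq_zero_iff_ae_notMem.1 (Measure.addHaar_sphere _ _ _)
    have n2 : ∀ᵐ v : E m, v ∉ sphere (0 : E m) (1 - δ) :=
      measure_eq_zero_iff_ae_notMem.1 (Measure.addHaar_sphere _ _ _)
    filter_upwards [n1, n2] with v hv1 hv2
    rw [lineDeriv_cutoff hδ hδ1 w (by simpa using hv1) (by simpa using hv2)]
    simp only [hS, Set.indicator]
    split_ifs <;> simp
  -- Polar coordinates factor the shell integral once `h` is evaluated at the direction `‖v‖⁻¹ • v`
  -- instead of at `v`.
  have h3 : (∫ ζ, inner ℝ (ζ : E m) w * h ζ ∂uniformSphere m) * (δ⁻¹ * ∫ v, S v)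
      = ∫ v, δ⁻¹ * S v * inner ℝ (‖v‖⁻¹ • v) w * h (‖v‖⁻¹ • v) := by
    have := integral_direction_mul_norm hm (fun y => inner ℝ y w * h y)
      (fun s => δ⁻¹ * (Set.Ioo (1 - δ) 1).indicator (fun _ => (1 : ℝ)) s)
    rw [integral_const_mul] at this
    rw [← this]
    exact integral_congr_ae (ae_of_all _ fun v => by simp only [hS]; ring)
  have hdirm : Measurable fun v : E m => ‖v‖⁻¹ • v := by fun_prop
  have hdir : ∀ v : E m, v ≠ 0 → ‖‖v‖⁻¹ • v‖ = 1 := fun v hv => by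
    rw [norm_smul, norm_inv, norm_norm, inv_mul_cancel₀ (norm_ne_zero_iff.2 hv)]
  -- Points of the shell are within `δ` of their radial projection, which cancels the density `δ⁻¹`
  -- and leaves an error proportional to the volume of the shell.
  have hnear : ∀ v : E m, 1 - δ < ‖v‖ → ‖v‖ < 1 → ‖h v - h (‖v‖⁻¹ • v)‖ ≤ K * δ := by
    intro v hv hv'
    have hv0 : 0 < ‖v‖ := by linarith
    rw [← dist_eq_norm]
    refine (hh.dist_le_mul _ _).trans ?_
    gcongr
    have : v - ‖v‖⁻¹ • v = (1 - ‖v‖⁻¹) • v := by rw [sub_smul, one_smul]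
    rw [dist_eq_norm, this, norm_smul, Real.norm_eq_abs, abs_sub_comm,
      abs_of_nonneg (by linarith [(one_le_inv₀ hv0).2 hv'.le]), sub_mul,
      inv_mul_cancel₀ hv0.ne']
    linarith
  obtain ⟨M, hM⟩ : ∃ M, ∀ y ∈ closedBall (0 : E m) 1, ‖h y‖ ≤ M :=
    (isCompact_closedBall (0 : E m) 1).exists_bound_of_continuousOn hh.continuous.continuousOn
  have hint : ∀ g : E m → E m, Measurable g → (∀ v, 1 - δ < ‖v‖ → ‖v‖ < 1 → ‖g v‖ ≤ 1) →
      Integrable fun v => δ⁻¹ * S v * inner ℝ (‖v‖⁻¹ • v) w * h (g v) := by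
    intro g hg hg1
    refine Integrable.mono' (hSint.const_mul (δ⁻¹ * ‖w‖ * M)) ?_ (ae_of_all _ fun v => ?_)
    · have := hh.continuous.measurable.comp hg
      exact (((hSm.const_mul _).mul (hdirm.inner measurable_const)).mul this).aestronglyMeasurable
    · rcases hSv v with ⟨hs, hv1, hv2⟩ | ⟨hs, -⟩
      · have hi : ‖inner ℝ (‖v‖⁻¹ • v) w‖ ≤ ‖w‖ := by
          refine (norm_inner_le_norm _ _).trans ?_
          rw [hdir v (norm_pos_iff.1 (by linarith)), one_mul]
        rw [hs, norm_mul, norm_mul, mul_one, mul_one, Real.norm_of_nonneg (inv_pos.2 hδ).le]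
        gcongr
        exact hM _ (mem_closedBall_zero_iff.2 (hg1 v hv1 hv2))
      · simp [hs]
  have h4 : |(∫ v, δ⁻¹ * S v * inner ℝ (‖v‖⁻¹ • v) w * h v)
      - ∫ v, δ⁻¹ * S v * inner ℝ (‖v‖⁻¹ • v) w * h (‖v‖⁻¹ • v)| ≤ K * ‖w‖ * ∫ v, S v := by
    rw [← integral_sub (hint (fun v => v) measurable_id fun v _ h => h.le)
      (hint _ hdirm fun v h _ => (hdir v (norm_pos_iff.1 (by linarith))).le),
      ← integral_const_mul, ← Real.norm_eq_abs]
    refine norm_integral_le_of_norm_le (hSint.const_mul _) (ae_of_all _ fun v => ?_)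
    rcases hSv v with ⟨hs, hv1, hv2⟩ | ⟨hs, -⟩
    · have hi : ‖inner ℝ (‖v‖⁻¹ • v) w‖ ≤ ‖w‖ := by
        refine (norm_inner_le_norm _ _).trans ?_
        rw [hdir v (norm_pos_iff.1 (by linarith)), one_mul]
      rw [← mul_sub, hs, norm_mul, norm_mul, mul_one, mul_one,
        Real.norm_of_nonneg (inv_pos.2 hδ).le]
      calc δ⁻¹ * ‖inner ℝ (‖v‖⁻¹ • v) w‖ * ‖h v - h (‖v‖⁻¹ • v)‖
          ≤ δ⁻¹ * ‖w‖ * (K * δ) := by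
            gcongr
            exact hnear v hv1 hv2
        _ = K * ‖w‖ := by field_simp
    · simp [hs]
  rw [h2] at h1
  rw [h3]
  refine (abs_sub_le _ _ _).trans ((add_le_add h1 h4).trans (le_of_eq ?_))
  ring

/-- The divergence theorem on the unit ball for Lipschitz functions. -/
theorem integral_ball_lineDeriv (hm : 1 ≤ m) {h : E m → ℝ} {K : NNReal}
    (hh : LipschitzWith K h) (w : E m) :
    ∫ v in ball (0 : E m) 1, lineDeriv ℝ h v w
      = (volume : Measure (E m)).real (ball 0 1)
        * (m * ∫ ζ, inner ℝ (ζ : E m) w * h ζ ∂uniformSphere m) := by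
  set D := ∫ v in ball (0 : E m) 1, lineDeriv ℝ h v w
  set I := ∫ ζ, inner ℝ (ζ : E m) w * h ζ ∂uniformSphere m
  set V := (volume : Measure (E m)).real (ball 0 1)
  have hd : HasDerivAt (fun δ : ℝ => 1 - (1 - δ) ^ m) (m : ℝ) 0 := by
    have := (((hasDerivAt_id (0 : ℝ)).const_sub 1).pow m).const_sub 1
    simpa using this
  -- The dimension factor `m` arises here, as the ratio of shell volume to `δ` times the ball
  -- volume.
  have hs : Tendsto (fun δ : ℝ => δ⁻¹ * (1 - (1 - δ) ^ m)) (nhdsWithin 0 (Set.Ioi 0))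
      (nhds (m : ℝ)) := by
    simpa using hd.tendsto_slope_zero_right
  have hz : Tendsto (fun δ : ℝ => 1 - (1 - δ) ^ m) (nhdsWithin 0 (Set.Ioi 0)) (nhds 0) := by
    have := hd.continuousAt.tendsto.mono_left (nhdsWithin_le_nhds (s := Set.Ioi (0 : ℝ)))
    simpa using this
  have hL : Tendsto (fun δ : ℝ => |D - I * (δ⁻¹ * (V * (1 - (1 - δ) ^ m)))|)
      (nhdsWithin 0 (Set.Ioi 0)) (nhds |D - I * (V * m)|) := by
    refine (((hs.const_mul V).const_mul I).const_sub D).abs.congr fun δ => ?_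
    congr 3
    ring
  have hR : Tendsto (fun δ : ℝ => 2 * K * ‖w‖ * (V * (1 - (1 - δ) ^ m)))
      (nhdsWithin 0 (Set.Ioi 0)) (nhds 0) := by
    simpa using (hz.const_mul V).const_mul (2 * K * ‖w‖)
  have := le_of_tendsto_of_tendsto hL hR (by
    filter_upwards [Ioo_mem_nhdsGT (zero_lt_one' ℝ)] with δ hδ
    exact abs_integral_lineDeriv_sub_le hm hh w hδ.1 hδ.2)
  have h0 := abs_nonpos_iff.1 this
  linarith

end Sphere

/-! ### Mean of the zeroth-order oracle -/

section Oracle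

open Metric

variable {m : ℕ} {f : E m → ℝ} {μ G : ℝ}

lemma lipschitzWith_comp_add_smul {G : NNReal} (hf : LipschitzWith G f) (hμ : 0 < μ) (x : E m) :
    LipschitzWith (G * Real.toNNReal μ) fun v => f (x + μ • v) - f x := by
  refine LipschitzWith.of_dist_le_mul fun v w => ?_
  rw [dist_sub_right]
  refine (hf.dist_le_mul _ _).trans (le_of_eq ?_)
  rw [dist_add_left, dist_smul₀, NNReal.coe_mul, Real.coe_toNNReal _ hμ.le, mul_assoc,
    Real.norm_of_nonneg hμ.le]

lemma volume_real_unitBall_pos : 0 < (volume : Measure (E m)).real (ball 0 1) :=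
  ENNReal.toReal_pos (measure_ball_pos _ _ one_pos).ne' measure_ball_lt_top.ne

/-- The mean of the oracle against a fixed direction, as an average of directional derivatives
over a ball. -/
lemma integral_inner_oracle (hm : 1 ≤ m) {G : NNReal} (hf : LipschitzWith G f) (hμ : 0 < μ)
    (x w : E m) :
    (volume : Measure (E m)).real (ball 0 1) * ∫ ζ, inner ℝ (oracle f μ x ζ) w ∂uniformSphere m
      = μ⁻¹ * ∫ v in ball (0 : E m) 1, lineDeriv ℝ (fun v => f (x + μ • v) - f x) v w := by
  have h : ∀ ζ : sphere (0 : E m) 1, inner ℝ (oracle f μ x ζ) w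
      = (m / μ) * (inner ℝ (ζ : E m) w * (f (x + μ • (ζ : E m)) - f x)) := fun ζ => by
    rw [oracle, real_inner_smul_left]
    ring
  rw [integral_ball_lineDeriv hm (lipschitzWith_comp_add_smul hf hμ x) w]
  simp only [h, integral_const_mul]
  ring

/-- The mean is an average of directional derivatives, each at most `G ‖w‖`, so the factor `m` of
the bound on a single sample is absent. -/
lemma integral_inner_oracle_le (hm : 1 ≤ m) {G : NNReal} (hf : LipschitzWith G f) (hμ : 0 < μ)
    (x w : E m) : ∫ ζ, inner ℝ (oracle f μ x ζ) w ∂uniformSphere m ≤ G * ‖w‖ := by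
  have hV := volume_real_unitBall_pos (m := m)
  refine le_of_mul_le_mul_left ?_ hV
  rw [integral_inner_oracle hm hf hμ, inv_mul_le_iff₀ hμ]
  have h1 : ‖∫ v in ball (0 : E m) 1, lineDeriv ℝ (fun v => f (x + μ • v) - f x) v w‖
      ≤ (G * μ * ‖w‖) * (volume : Measure (E m)).real (ball 0 1) := by
    refine norm_setIntegral_le_of_norm_le_const measure_ball_lt_top fun v _ => ?_
    refine (norm_lineDeriv_le_of_lipschitz ℝ (lipschitzWith_comp_add_smul hf hμ x)).trans
      (le_of_eq ?_)
    rw [NNReal.coe_mul, Real.coe_toNNReal _ hμ.le]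
  refine (Real.le_norm_self _).trans (h1.trans (le_of_eq ?_))
  ring

lemma integral_ball_inner (g : E m) : ∫ v in ball (0 : E m) 1, inner ℝ g v = 0 := by
  have h := integral_neg_eq_self
    (fun v : E m => (ball (0 : E m) 1).indicator (fun v => inner ℝ g v) v) volume
  have h2 : ∀ v : E m, (ball (0 : E m) 1).indicator (fun v => inner ℝ g v) (-v)
      = -(ball (0 : E m) 1).indicator (fun v => inner ℝ g v) v := fun v => by
    simp only [Set.indicator, mem_ball_zero_iff, norm_neg, inner_neg_right]
    split_ifs <;> simp
  simp only [h2, integral_neg] at h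
  rw [← integral_indicator measurableSet_ball]
  linarith

/-- A one-sided derivative of a convex function is at most any difference quotient. -/
lemma hasLineDerivAt_le_of_convexOn {K : Set (E m)} (hf : ConvexOn ℝ K f) {y z : E m}
    (hy : y ∈ K) (hz : z ∈ K) {d : ℝ} (hd : HasLineDerivAt ℝ f d y (z - y)) :
    d ≤ f z - f y := by
  have ht := HasDerivAt.tendsto_slope_zero_right hd
  refine le_of_tendsto ht ?_
  filter_upwards [Ioo_mem_nhdsGT (zero_lt_one' ℝ)] with s hs
  simp only [zero_add, zero_smul, add_zero, smul_eq_mul]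
  rw [inv_mul_le_iff₀ hs.1]
  have h := hf.2 hy hz (sub_nonneg.2 hs.2.le) hs.1.le (by ring)
  rw [show (1 - s) • y + s • z = y + s • (z - y) by
    rw [sub_smul, smul_sub, one_smul]; abel] at h
  simp only [smul_eq_mul] at h
  linarith

/-- The oracle at `x` is, in mean, an approximate subgradient. -/
lemma le_integral_inner_oracle (hm : 1 ≤ m) {G : NNReal} (hf : LipschitzWith G f) (hμ : 0 < μ)
    {K : Set (E m)} (hc : ConvexOn ℝ K f) {x u : E m}
    (hx : ∀ v ∈ closedBall (0 : E m) 1, x + μ • v ∈ K)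
    (hu : ∀ v ∈ closedBall (0 : E m) 1, u + μ • v ∈ K)
    {g : E m} (hg : g ∈ subdifferentialOn K f x) :
    f x - f u - G * μ ≤ ∫ ζ, inner ℝ (oracle f μ x ζ) (x - u) ∂uniformSphere m := by
  have hV := volume_real_unitBall_pos (m := m)
  set h : E m → ℝ := fun v => f (x + μ • v) - f x with hh
  have hhl := lipschitzWith_comp_add_smul hf hμ x
  -- Smoothing at `x` costs nothing: the subgradient bound there has a linear term odd in `v`, which
  -- integrates to zero. The loss `G * μ` comes from `u` alone.
  have hpt : ∀ᵐ v, v ∈ ball (0 : E m) 1 →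
      lineDeriv ℝ h v (u - x) ≤ μ * (f u - f x + G * μ) - μ * inner ℝ (μ • g) v := by
    filter_upwards [hhl.ae_lineDifferentiableAt (u - x)] with v hv hvb
    have hvc : v ∈ closedBall (0 : E m) 1 := ball_subset_closedBall hvb
    have hd := hv.hasLineDerivAt
    have hd' : HasLineDerivAt ℝ f (μ⁻¹ * lineDeriv ℝ h v (u - x)) (x + μ • v)
        (u + μ • v - (x + μ • v)) := by
      -- Moving `v` by `s • (u - x)` moves the argument of `f` by `s * μ` times `u - x`, so `s` is
      -- rescaled by `μ⁻¹`. The base point `μ⁻¹ * 0` has the shape the chain rule asks for.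
      have h0 : HasDerivAt (fun s : ℝ => h (v + s • (u - x))) (lineDeriv ℝ h v (u - x))
          (μ⁻¹ * 0) := by rw [mul_zero]; exact hd
      have h1 := (h0.comp (0 : ℝ) ((hasDerivAt_id (0 : ℝ)).const_mul μ⁻¹)).add_const (f x)
      have e : (fun s : ℝ => f (x + μ • v + s • (u + μ • v - (x + μ • v))))
          = fun s : ℝ => ((fun s : ℝ => h (v + s • (u - x))) ∘ fun s => μ⁻¹ * id s) s + f x := by
        funext s
        simp only [hh, Function.comp, id, sub_add_cancel, add_sub_add_right_eq_sub, smul_add,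
          smul_smul, mul_inv_cancel_left₀ hμ.ne', add_assoc]
      rw [HasLineDerivAt, e, mul_comm]
      simpa using h1
    have h1 := hasLineDerivAt_le_of_convexOn hc (hx v hvc) (hu v hvc) hd'
    rw [inv_mul_le_iff₀ hμ] at h1
    have h2 := hg _ (hx v hvc)
    have h3 : f (u + μ • v) ≤ f u + G * μ := by
      have := (hf.dist_le_mul (u + μ • v) u)
      rw [Real.dist_eq, dist_self_add_left, norm_smul, Real.norm_of_nonneg hμ.le] at this
      have h4 : (G : ℝ) * (μ * ‖v‖) ≤ G * μ := by
        have := mem_closedBall_zero_iff.1 hvc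
        gcongr
        exact mul_le_of_le_one_right hμ.le this
      linarith [le_abs_self (f (u + μ • v) - f u)]
    rw [add_sub_cancel_left, real_inner_smul_right] at h2
    rw [real_inner_smul_left]
    refine h1.trans ?_
    rw [← mul_sub]
    exact mul_le_mul_of_nonneg_left (by linarith) hμ.le
  have hfin : volume (ball (0 : E m) 1) ≠ ⊤ := measure_ball_lt_top.ne
  have hi1 : IntegrableOn (fun v : E m => inner ℝ (μ • g) v) (ball 0 1) := by
    refine Measure.integrableOn_of_bounded (M := ‖μ • g‖) hfin (by fun_prop) ?_
    refine (ae_restrict_iff' measurableSet_ball).2 (ae_of_all _ fun v hv => ?_)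
    refine (norm_inner_le_norm _ _).trans (mul_le_of_le_one_right (norm_nonneg _) ?_)
    exact (mem_ball_zero_iff.1 hv).le
  have hi2 : IntegrableOn (fun v : E m => lineDeriv ℝ h v (u - x)) (ball 0 1) :=
    Measure.integrableOn_of_bounded (M := (G * Real.toNNReal μ : NNReal) * ‖u - x‖) hfin
      (measurable_lineDeriv hhl.continuous).aestronglyMeasurable
      (ae_of_all _ fun v => norm_lineDeriv_le_of_lipschitz ℝ hhl)
  have hi3 : IntegrableOn (fun _ : E m => μ * (f u - f x + G * μ)) (ball 0 1) :=
    integrableOn_const hfin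
  have hint := setIntegral_mono_on_ae hi2 (hi3.sub (hi1.const_mul μ)) measurableSet_ball hpt
  rw [integral_sub' hi3 (hi1.const_mul μ), setIntegral_const, integral_const_mul,
    integral_ball_inner, mul_zero, sub_zero, smul_eq_mul] at hint
  have hneg : ∫ ζ, inner ℝ (oracle f μ x ζ) (x - u) ∂uniformSphere m
      = -∫ ζ, inner ℝ (oracle f μ x ζ) (u - x) ∂uniformSphere m := by
    rw [← integral_neg]
    exact integral_congr_ae (ae_of_all _ fun ζ => by
      simp only [← inner_neg_right, neg_sub])
  have hmain := integral_inner_oracle hm hf hμ x (u - x)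
  have : ∫ ζ, inner ℝ (oracle f μ x ζ) (u - x) ∂uniformSphere m ≤ f u - f x + G * μ := by
    refine le_of_mul_le_mul_left ?_ hV
    rw [hmain, inv_mul_le_iff₀ hμ]
    refine hint.trans (le_of_eq ?_)
    ring
  rw [hneg]
  linarith

end Oracle

/-! ### Projection onto a closed convex set -/

section Projection

variable {m : ℕ} {K : Set (E m)}

lemma proj_spec (hne : K.Nonempty) (hc : IsClosed K) (hconv : Convex ℝ K) (x : E m) :
    proj K x ∈ K ∧ ∀ w ∈ K, inner ℝ (x - proj K x) (w - proj K x) ≤ 0 := by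
  have hmin : ∃ w, w ∈ K ∧ IsMinOn (fun v => ‖v - x‖ ^ 2) K w := by
    obtain ⟨w, hw, hw'⟩ := hc.exists_infDist_eq_dist hne x
    refine ⟨w, hw, fun v hv => ?_⟩
    have := Metric.infDist_le_dist_of_mem (x := x) hv
    rw [hw', dist_comm, dist_comm x v, dist_eq_norm, dist_eq_norm] at this
    exact pow_le_pow_left₀ (norm_nonneg _) this 2
  obtain ⟨h1, h2⟩ : proj K x ∈ K ∧ IsMinOn (fun v => ‖v - x‖ ^ 2) K (proj K x) :=
    Classical.epsilon_spec hmin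
  refine ⟨h1, ?_⟩
  rw [← norm_eq_iInf_iff_real_inner_le_zero hconv h1]
  have : Nonempty K := ⟨⟨_, h1⟩⟩
  refine le_antisymm (le_ciInf fun w => ?_)
    (ciInf_le (f := fun w : K => ‖x - w‖) ⟨0, by rintro _ ⟨w, rfl⟩; exact norm_nonneg _⟩ ⟨_, h1⟩)
  rw [norm_sub_rev, norm_sub_rev x]
  exact (pow_le_pow_iff_left₀ (norm_nonneg _) (norm_nonneg _) two_ne_zero).1 (h2 w.2)

lemma norm_proj_sub_proj_le (hne : K.Nonempty) (hc : IsClosed K) (hconv : Convex ℝ K)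
    (x y : E m) : ‖proj K x - proj K y‖ ≤ ‖x - y‖ := by
  obtain ⟨hx, hx'⟩ := proj_spec hne hc hconv x
  obtain ⟨hy, hy'⟩ := proj_spec hne hc hconv y
  set a := proj K x
  set b := proj K y
  have h1 := hx' b hy
  have h2 := hy' a hx
  have h3 : ‖a - b‖ ^ 2 ≤ inner ℝ (x - y) (a - b) := by
    rw [← real_inner_self_eq_norm_sq]
    have e : inner ℝ (x - y) (a - b) - inner ℝ (a - b) (a - b)
        = -inner ℝ (x - a) (b - a) - inner ℝ (y - b) (a - b) := by
      simp only [inner_sub_left, inner_sub_right]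
      ring
    linarith
  have h4 := h3.trans (real_inner_le_norm (x - y) (a - b))
  by_cases h0 : ‖a - b‖ = 0
  · rw [h0]; exact norm_nonneg _
  · have : 0 < ‖a - b‖ := (norm_nonneg _).lt_of_ne' h0
    nlinarith

lemma continuous_proj (hne : K.Nonempty) (hc : IsClosed K) (hconv : Convex ℝ K) :
    Continuous (proj K) :=
  (LipschitzWith.of_dist_le_mul (K := 1) fun x y => by
    simpa [dist_eq_norm] using norm_proj_sub_proj_le hne hc hconv x y).continuous

lemma proj_eq_self (hne : K.Nonempty) (hc : IsClosed K) (hconv : Convex ℝ K) {x : E m}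
    (hx : x ∈ K) : proj K x = x := by
  have h := (proj_spec hne hc hconv x).2 x hx
  rw [real_inner_self_eq_norm_sq] at h
  have : ‖x - proj K x‖ = 0 := by nlinarith [norm_nonneg (x - proj K x)]
  exact (sub_eq_zero.1 (norm_eq_zero.1 this)).symm

lemma norm_proj_sub_le (hne : K.Nonempty) (hc : IsClosed K) (hconv : Convex ℝ K) {u : E m}
    (hu : u ∈ K) (x : E m) : ‖proj K x - u‖ ≤ ‖x - u‖ := by
  simpa only [proj_eq_self hne hc hconv hu] using norm_proj_sub_proj_le hne hc hconv x u

end Projection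

/-! ### Costs and the shrunk constraint set -/

section Cost

variable {n m : ℕ} {Ω : Set (E m)} {r R G ξ : ℝ} {f : Fin n → ℕ → E m → ℝ}

namespace CostAssumption

variable (hf : CostAssumption Ω r R G f)

include hf

lemma norm_le {x : E m} (hx : x ∈ Ω) : ‖x‖ ≤ R :=
  mem_closedBall_zero_iff.1 (hf.subset_ball hx)

lemma r_le_R (hm : 1 ≤ m) : r ≤ R := by
  have := nontrivial_E hm
  obtain ⟨v, hv⟩ := exists_norm_eq (E m) hf.r_pos.le
  rw [← hv]
  exact hf.norm_le (hf.ball_subset (mem_closedBall_zero_iff.2 hv.le))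

lemma isCompact : IsCompact Ω :=
  (isCompact_closedBall (0 : E m) R).of_isClosed_subset hf.closed hf.subset_ball

lemma sub_le (i : Fin n) (t : ℕ) {x y : E m} (hx : x ∈ Ω) (hy : y ∈ Ω) :
    f i t x - f i t y ≤ G * ‖x - y‖ := by
  obtain ⟨g, hg, hgG⟩ := hf.bounded_subgradient i t x hx
  have h1 := hg y hy
  have h2 := (neg_le_abs _).trans (abs_real_inner_le_norm g (y - x))
  have h3 : ‖g‖ * ‖y - x‖ ≤ G * ‖x - y‖ := by
    rw [norm_sub_rev y x]
    exact mul_le_mul_of_nonneg_right hgG (norm_nonneg _)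
  linarith

lemma lipschitzOnWith (i : Fin n) (t : ℕ) : LipschitzOnWith (Real.toNNReal G) (f i t) Ω := by
  refine LipschitzOnWith.of_dist_le_mul fun x hx y hy => ?_
  rw [Real.coe_toNNReal _ hf.G_pos.le, Real.dist_eq, dist_eq_norm, abs_le]
  have h1 := hf.sub_le i t hx hy
  have h2 := hf.sub_le i t hy hx
  rw [norm_sub_rev] at h2
  exact ⟨by linarith, h1⟩

lemma congr {f' : Fin n → ℕ → E m → ℝ} (h : ∀ i t, Set.EqOn (f i t) (f' i t) Ω) :
    CostAssumption Ω r R G f' where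
  nonempty := hf.nonempty
  convex := hf.convex
  closed := hf.closed
  r_pos := hf.r_pos
  R_pos := hf.R_pos
  ball_subset := hf.ball_subset
  subset_ball := hf.subset_ball
  G_pos := hf.G_pos
  convex_cost i t := (hf.convex_cost i t).congr (h i t)
  bounded_subgradient i t x hx := by
    obtain ⟨g, hg, hgG⟩ := hf.bounded_subgradient i t x hx
    refine ⟨g, fun y hy => ?_, hgG⟩
    rw [← h i t hx, ← h i t hy]
    exact hg y hy

/-- The costs can be changed off `Ω` so as to become globally Lipschitz. -/
lemma exists_lipschitz_extension : ∃ f' : Fin n → ℕ → E m → ℝ,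
    (∀ i t, LipschitzWith (Real.toNNReal G) (f' i t)) ∧ ∀ i t, Set.EqOn (f i t) (f' i t) Ω := by
  choose f' h1 h2 using fun i t => (hf.lipschitzOnWith i t).extend_real
  exact ⟨f', h1, h2⟩

lemma shrink_nonempty : ((1 - ξ) • Ω).Nonempty := hf.nonempty.smul_set

lemma isCompact_shrink : IsCompact ((1 - ξ) • Ω) := hf.isCompact.smul (1 - ξ)

lemma isClosed_shrink : IsClosed ((1 - ξ) • Ω) := hf.isCompact_shrink.isClosed

lemma convex_shrink : Convex ℝ ((1 - ξ) • Ω) := hf.convex.smul _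

/-- The point is the convex combination of some `y ∈ Ω` and `r • v ∈ Ω` with weights `1 - ξ` and
`ξ`. With `μ = ξ * r` every oracle query therefore stays in `Ω`. -/
lemma add_smul_mem (hξ0 : 0 ≤ ξ) (hξ1 : ξ ≤ 1) {x v : E m} (hx : x ∈ (1 - ξ) • Ω)
    (hv : v ∈ Metric.closedBall (0 : E m) 1) : x + (ξ * r) • v ∈ Ω := by
  obtain ⟨y, hy, rfl⟩ := hx
  rw [mul_smul]
  refine hf.convex hy (hf.ball_subset ?_) (by linarith) hξ0 (by ring)
  rw [mem_closedBall_zero_iff, norm_smul, Real.norm_of_nonneg hf.r_pos.le]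
  exact mul_le_of_le_one_right hf.r_pos.le (mem_closedBall_zero_iff.1 hv)

lemma shrink_subset (hξ0 : 0 ≤ ξ) (hξ1 : ξ ≤ 1) : (1 - ξ) • Ω ⊆ Ω := fun x hx => by
  simpa using hf.add_smul_mem hξ0 hξ1 hx (Metric.mem_closedBall_self zero_le_one)

lemma norm_oracle_le (i : Fin n) (t : ℕ) (hξ0 : 0 < ξ) (hξ1 : ξ ≤ 1) {x v : E m}
    (hx : x ∈ (1 - ξ) • Ω) (hv : ‖v‖ = 1) : ‖oracle (f i t) (ξ * r) x v‖ ≤ m * G := by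
  have hμ : 0 < ξ * r := mul_pos hξ0 hf.r_pos
  have h1 := hf.add_smul_mem hξ0.le hξ1 hx (mem_closedBall_zero_iff.2 hv.le)
  have h2 := (hf.lipschitzOnWith i t).dist_le_mul _ h1 _ (hf.shrink_subset hξ0.le hξ1 hx)
  rw [Real.coe_toNNReal _ hf.G_pos.le, dist_self_add_left, norm_smul, hv, mul_one,
    Real.norm_of_nonneg hμ.le, Real.dist_eq] at h2
  rw [oracle, norm_smul, hv, mul_one, norm_mul, Real.norm_eq_abs (_ - _),
    Real.norm_of_nonneg (by positivity)]
  calc (m : ℝ) / (ξ * r) * |f i t (x + (ξ * r) • v) - f i t x|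
      ≤ m / (ξ * r) * (G * (ξ * r)) := by gcongr
    _ = m * G := by
      rw [div_mul_eq_mul_div, mul_div_assoc, mul_div_assoc, div_self hμ.ne', mul_one]

end CostAssumption

end Cost

/-! ### The decisions along one realization of the noise -/

section Decisions

variable {n m : ℕ} {A : ℕ → Matrix (Fin n) (Fin n) ℝ} {γ : ℝ} {B : ℕ}
  {Ω : Set (E m)} {r R G ξ μ : ℝ} {f : Fin n → ℕ → E m → ℝ} {α : ℕ → ℝ} {x0 : Fin n → E m}
  {z : Fin n → ℕ → E m}

/-- The weighted average of the neighbours' states. -/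
noncomputable def average (A : ℕ → Matrix (Fin n) (Fin n) ℝ) (t : ℕ) (x : Fin n → E m)
    (i : Fin n) : E m :=
  ∑ j, mix A t i j • x j

lemma decisions_succ (t : ℕ) (i : Fin n) :
    decisions A Ω f μ ξ α x0 z (t + 1) i = proj ((1 - ξ) • Ω)
      (average A t (decisions A Ω f μ ξ α x0 z t) i - (1 / phi A (t + 1) i * α t) •
        oracle (f i t) μ (decisions A Ω f μ ξ α x0 z t i) (z i t)) := rfl

lemma CostAssumption.decisions_mem (hf : CostAssumption Ω r R G f)
    (hx0 : ∀ i, x0 i ∈ (1 - ξ) • Ω) (t : ℕ) (i : Fin n) :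
    decisions A Ω f μ ξ α x0 z t i ∈ (1 - ξ) • Ω := by
  cases t with
  | zero => exact hx0 i
  | succ t =>
    exact (proj_spec hf.shrink_nonempty hf.isClosed_shrink hf.convex_shrink _).1

lemma average_mem (hA : NetworkAssumption A γ B) (hγ : 0 < γ) {K : Set (E m)} (hK : Convex ℝ K)
    {x : Fin n → E m} (hx : ∀ i, x i ∈ K) (t : ℕ) (i : Fin n) : average A t x i ∈ K :=
  hK.sum_mem (fun _ _ => hA.mix_nonneg hγ t i _) (hA.sum_mix hγ t i) fun j _ => hx j

/-- The decisions depend only on the values of the costs on `Ω`. -/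
lemma CostAssumption.decisions_congr (hf : CostAssumption Ω r R G f)
    {f' : Fin n → ℕ → E m → ℝ} (h : ∀ i t, Set.EqOn (f i t) (f' i t) Ω)
    (hξ0 : 0 ≤ ξ) (hξ1 : ξ ≤ 1) (hx0 : ∀ i, x0 i ∈ (1 - ξ) • Ω) (hz : ∀ i t, ‖z i t‖ = 1)
    (t : ℕ) :
    decisions A Ω f' (ξ * r) ξ α x0 z t = decisions A Ω f (ξ * r) ξ α x0 z t := by
  induction t with
  | zero => rfl
  | succ t ih =>
    funext i
    have hx := hf.decisions_mem (A := A) (μ := ξ * r) (α := α) (z := z) hx0 t i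
    rw [decisions_succ, decisions_succ, ih, oracle, oracle,
      h i t (hf.add_smul_mem hξ0 hξ1 hx (mem_closedBall_zero_iff.2 (hz i t).le)),
      h i t (hf.shrink_subset hξ0 hξ1 hx)]

lemma continuous_average (t : ℕ) (i : Fin n) :
    Continuous fun x : Fin n → E m => average A t x i := by
  unfold average
  fun_prop

lemma continuous_oracle {f : E m → ℝ} (hf : Continuous f) :
    Continuous fun p : E m × E m => oracle f μ p.1 p.2 := by
  unfold oracle
  fun_prop

/-- For continuous costs the decisions depend continuously on the noise. -/
lemma CostAssumption.continuous_decisions (hf : CostAssumption Ω r R G f)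
    (hc : ∀ i t, Continuous (f i t)) (t : ℕ) :
    Continuous fun z : Fin n → ℕ → E m => decisions A Ω f μ ξ α x0 z t := by
  induction t with
  | zero => exact continuous_const
  | succ t ih =>
    refine continuous_pi fun i => ?_
    simp only [decisions_succ]
    refine (continuous_proj hf.shrink_nonempty hf.isClosed_shrink hf.convex_shrink).comp ?_
    have ho : Continuous fun z : Fin n → ℕ → E m =>
        oracle (f i t) μ (decisions A Ω f μ ξ α x0 z t i) (z i t) :=
      (continuous_oracle (hc i t)).comp
        (((continuous_apply i).comp ih).prodMk
          ((continuous_apply t).comp (continuous_apply i)))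
    exact ((continuous_average t i).comp ih).sub (ho.fun_const_smul _)

/-- The decisions at time `t` depend only on the noise before time `t`. -/
lemma decisions_eq_of_noise_eq {z z' : Fin n → ℕ → E m} (t : ℕ)
    (h : ∀ i, ∀ s < t, z i s = z' i s) :
    decisions A Ω f μ ξ α x0 z t = decisions A Ω f μ ξ α x0 z' t := by
  induction t with
  | zero => rfl
  | succ t ih =>
    funext i
    rw [decisions_succ, decisions_succ, ih fun i s hs => h i s (by omega), h i t (by omega)]

end Decisions

/-! ### Consensus of perturbed averaging -/

section Consensus

variable {n m : ℕ} {A : ℕ → Matrix (Fin n) (Fin n) ℝ} {γ : ℝ} {B : ℕ} {C lam θ : ℝ}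

/-- Discrete variation of constants. The perturbation `e s` enters at time `s + 1`, so `t - 1 - s`
matrices act on it; the truncated subtraction is exact because `s < t`. -/
lemma perturbed_average_eq {x e : ℕ → Fin n → E m}
    (hx : ∀ t i, x (t + 1) i = average A t (x t) i + e t i) (t : ℕ) (i : Fin n) :
    x t i = ∑ k, mixProd A 0 t i k • x 0 k
      + ∑ s ∈ Finset.range t, ∑ k, mixProd A (s + 1) (t - 1 - s) i k • e s k := by
  induction t generalizing i with
  | zero => simp [mixProd, Matrix.one_apply]
  | succ t ih =>
    have hlin : ∀ (M : Matrix (Fin n) (Fin n) ℝ) (v : Fin n → E m),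
        ∑ j, mix A t i j • ∑ k, M j k • v k = ∑ k, (mix A t * M) i k • v k := by
      intro M v
      simp only [Finset.smul_sum, smul_smul, Matrix.mul_apply, Finset.sum_smul]
      exact Finset.sum_comm
    have hav : average A t (x t) i = ∑ k, mixProd A 0 (t + 1) i k • x 0 k
        + ∑ s ∈ Finset.range t, ∑ k, mixProd A (s + 1) (t - s) i k • e s k := by
      rw [average, Finset.sum_congr rfl fun j _ => by rw [ih j]]
      simp only [smul_add, Finset.sum_add_distrib]
      congr 1
      · rw [hlin, mixProd, Nat.zero_add]
      · simp only [Finset.smul_sum (s := Finset.range t)]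
        rw [Finset.sum_comm]
        refine Finset.sum_congr rfl fun s hs => ?_
        have hs' := Finset.mem_range.1 hs
        rw [hlin, show t - s = (t - 1 - s) + 1 by omega, mixProd,
          show s + 1 + (t - 1 - s) = t by omega]
    rw [hx, hav, Finset.sum_range_succ, add_tsub_cancel_right, Nat.sub_self, add_assoc]
    congr 2
    simp [mixProd, Matrix.one_apply]

/-- A majorant of the disagreement of perturbed averaging with perturbations of size `ε t`. -/
def disagreement (n : ℕ) (C lam S : ℝ) (ε : ℕ → ℝ) : ℕ → ℝ
  | 0 => C * S
  | t + 1 => lam * disagreement n C lam S ε t + C * n * ε t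

lemma disagreement_eq (S : ℝ) (ε : ℕ → ℝ) (t : ℕ) :
    disagreement n C lam S ε t = C * lam ^ t * S
      + ∑ s ∈ Finset.range t, C * lam ^ (t - 1 - s) * (n * ε s) := by
  induction t with
  | zero => simp [disagreement]
  | succ t ih =>
    rw [disagreement, ih, Finset.sum_range_succ, mul_add, Finset.mul_sum,
      Finset.sum_congr rfl fun s hs => ?_]
    · simp only [add_tsub_cancel_right, Nat.sub_self, pow_zero]
      ring
    · have hs' := Finset.mem_range.1 hs
      rw [show t - s = t - 1 - s + 1 by omega, pow_succ]
      ring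

lemma NetworkConstants.disagreement_nonneg (hC : NetworkConstants A C lam θ) {S : ℝ} (hS : 0 ≤ S)
    {ε : ℕ → ℝ} (hε : ∀ t, 0 ≤ ε t) (t : ℕ) : 0 ≤ disagreement n C lam S ε t := by
  have h1 := hC.C_pos
  have h2 := hC.lam_pos
  induction t with
  | zero => exact mul_nonneg h1.le hS
  | succ t ih =>
    have := hε t
    rw [disagreement]
    positivity

lemma NetworkConstants.sum_disagreement_le (hC : NetworkConstants A C lam θ) {S : ℝ} (hS : 0 ≤ S)
    {ε : ℕ → ℝ} (hε : ∀ t, 0 ≤ ε t) (N : ℕ) :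
    ∑ t ∈ Finset.range N, disagreement n C lam S ε t
      ≤ (C * S + C * n * ∑ t ∈ Finset.range N, ε t) / (1 - lam) := by
  have h : ∀ N, (1 - lam) * ∑ t ∈ Finset.range N, disagreement n C lam S ε t
      + disagreement n C lam S ε N = C * S + C * n * ∑ t ∈ Finset.range N, ε t := by
    intro N
    induction N with
    | zero => simp [disagreement]
    | succ N ih =>
      rw [Finset.sum_range_succ, Finset.sum_range_succ, disagreement]
      linear_combination ih
  rw [le_div_iff₀ (by linarith [hC.lam_lt_one])]
  linarith [h N, hC.disagreement_nonneg hS hε N]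

/-- Perturbed averaging stays close to consensus. -/
lemma NetworkConstants.exists_center (hC : NetworkConstants A C lam θ)
    {x e : ℕ → Fin n → E m} {ε : ℕ → ℝ}
    (hx : ∀ t i, x (t + 1) i = average A t (x t) i + e t i) (he : ∀ t i, ‖e t i‖ ≤ ε t) :
    ∃ c : ℕ → E m, ∀ t i, ‖x t i - c t‖ ≤ disagreement n C lam (∑ i, ‖x 0 i‖) ε t := by
  obtain ⟨π, -, hπ⟩ := hC.mixing
  -- The centre replaces each product of mixing matrices in `perturbed_average_eq` by its limiting
  -- row, which is the same for all nodes.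
  refine ⟨fun t => ∑ k, π 0 k • x 0 k + ∑ s ∈ Finset.range t, ∑ k, π (s + 1) k • e s k,
    fun t i => ?_⟩
  have hlin : ∀ (s l : ℕ) (v : Fin n → E m) (M : ℝ), ∑ k, ‖v k‖ ≤ M →
      ‖∑ k, mixProd A s l i k • v k - ∑ k, π s k • v k‖ ≤ C * lam ^ l * M := by
    intro s l v M hM
    have h0 : 0 ≤ C * lam ^ l := mul_nonneg hC.C_pos.le (pow_nonneg hC.lam_pos.le _)
    rw [← Finset.sum_sub_distrib]
    refine (norm_sum_le _ _).trans (le_trans ?_ (mul_le_mul_of_nonneg_left hM h0))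
    rw [Finset.mul_sum]
    refine Finset.sum_le_sum fun k _ => ?_
    rw [← sub_smul, norm_smul]
    exact mul_le_mul_of_nonneg_right (hπ s l i k) (norm_nonneg _)
  have h1 := hlin 0 t (x 0) _ le_rfl
  have h2 : ∀ s ∈ Finset.range t, ‖∑ k, mixProd A (s + 1) (t - 1 - s) i k • e s k
      - ∑ k, π (s + 1) k • e s k‖ ≤ C * lam ^ (t - 1 - s) * (n * ε s) := fun s _ => by
    refine hlin (s + 1) (t - 1 - s) (e s) _ ((Finset.sum_le_sum fun k _ => he s k).trans ?_)
    simp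
  have h3 := norm_sum_le_of_le _ h2
  rw [Finset.sum_sub_distrib] at h3
  rw [perturbed_average_eq hx t i, disagreement_eq, add_sub_add_comm]
  exact norm_add_le_of_le h1 h3

lemma norm_average_sub_le (hA : NetworkAssumption A γ B) (hγ : 0 < γ) {x : Fin n → E m} {c : E m}
    {d : ℝ} (hd : ∀ i, ‖x i - c‖ ≤ d) (t : ℕ) (i : Fin n) : ‖average A t x i - c‖ ≤ d :=
  mem_closedBall_iff_norm.1 (average_mem hA hγ (convex_closedBall c d)
    (fun i => mem_closedBall_iff_norm.2 (hd i)) t i)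

end Consensus

/-! ### Elementary sums -/

lemma sum_inv_sqrt_le (N : ℕ) : ∑ t ∈ Finset.range N, 1 / √((t : ℝ) + 1) ≤ 2 * √(N : ℝ) := by
  induction N with
  | zero => simp
  | succ N ih =>
    rw [Finset.sum_range_succ]
    push_cast
    have h1 : 0 < √((N : ℝ) + 1) := Real.sqrt_pos.2 (by positivity)
    have h2 := Real.sq_sqrt (by positivity : (0 : ℝ) ≤ (N : ℝ) + 1)
    have h3 := Real.sq_sqrt (by positivity : (0 : ℝ) ≤ (N : ℝ))
    have h4 : 1 / √((N : ℝ) + 1) ≤ 2 * (√((N : ℝ) + 1) - √(N : ℝ)) := by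
      rw [div_le_iff₀ h1]
      nlinarith [sq_nonneg (√((N : ℝ) + 1) - √(N : ℝ))]
    linarith

/-- Summation by parts with nondecreasing weights. -/
lemma sum_mul_sub_le {w a b v : ℕ → ℝ} {M : ℝ} (hw0 : ∀ t, 0 ≤ w t) (hw : Monotone w)
    (ha : ∀ t, a t ≤ M) (hb : ∀ t, 0 ≤ b t) (hv : ∀ t, 0 ≤ v t)
    (hab : ∀ t, a (t + 1) ≤ b t + v t) (T : ℕ) :
    ∑ t ∈ Finset.range (T + 1), w t * (a t - b t)
      ≤ w T * (M + ∑ t ∈ Finset.range (T + 1), v t) := by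
  -- The extra term `w T * a T` closes the induction: raising its weight to `w (T + 1)` costs at
  -- most `(w (T + 1) - w T) * M`.
  have key : ∀ T, ∑ t ∈ Finset.range T, w t * (a t - b t) + w T * a T
      ≤ w T * M + ∑ t ∈ Finset.range T, w t * v t := by
    intro T
    induction T with
    | zero => simpa using mul_le_mul_of_nonneg_left (ha 0) (hw0 0)
    | succ T ih =>
      rw [Finset.sum_range_succ, Finset.sum_range_succ]
      have h1 := mul_nonneg (sub_nonneg.2 (hw (Nat.le_succ T))) (sub_nonneg.2 (ha (T + 1)))
      have h2 := mul_le_mul_of_nonneg_left (hab T) (hw0 T)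
      simp only [Nat.succ_eq_add_one] at h1
      nlinarith
  have h1 : ∑ t ∈ Finset.range T, w t * v t ≤ w T * ∑ t ∈ Finset.range T, v t := by
    rw [Finset.mul_sum]
    exact Finset.sum_le_sum fun t ht =>
      mul_le_mul_of_nonneg_right (hw (Finset.mem_range.1 ht).le) (hv t)
  rw [Finset.sum_range_succ, Finset.sum_range_succ]
  nlinarith [key T, mul_nonneg (hw0 T) (hb T), mul_nonneg (hw0 T) (hv T)]

/-! ### The regret along one realization of the noise -/

section Pathwise

variable {n m : ℕ} {A : ℕ → Matrix (Fin n) (Fin n) ℝ} {γ : ℝ} {B : ℕ} {C lam θ : ℝ}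
  {Ω : Set (E m)} {r R G ξ : ℝ} {f : Fin n → ℕ → E m → ℝ} {xs : ℕ → E m} {x0 : Fin n → E m}
  {z : Fin n → ℕ → E m}

/-- The weighted square distance of the states to `u`. -/
noncomputable def energy (A : ℕ → Matrix (Fin n) (Fin n) ℝ) (t : ℕ) (x : Fin n → E m) (u : E m) :
    ℝ :=
  ∑ i, phi A t i * ‖x i - u‖ ^ 2

/-- The amount by which one sample of the oracle beats the guaranteed mean behaviour. -/
noncomputable def oracleGap (A : ℕ → Matrix (Fin n) (Fin n) ℝ) (f : Fin n → ℕ → E m → ℝ)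
    (μ G : ℝ) (t : ℕ) (i : Fin n) (u : E m) (x : Fin n → E m) (ζ : E m) : ℝ :=
  inner ℝ (oracle (f i t) μ (x i) ζ) (average A t x i - u)
    - (f i t (x i) - f i t u - G * μ - G * ‖average A t x i - x i‖)

lemma NetworkConstants.one_le_θ (hC : NetworkConstants A C lam θ) (i : Fin n) : 1 ≤ θ := by
  have := hC.phi_lower 0 i
  simp only [phi] at this
  exact (inv_le_one₀ hC.θ_pos).1 this

lemma NetworkConstants.phi_pos (hC : NetworkConstants A C lam θ) (t : ℕ) (i : Fin n) :
    0 < phi A t i := (inv_pos.2 hC.θ_pos).trans_le (hC.phi_lower t i)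

lemma NetworkConstants.inv_phi_le (hC : NetworkConstants A C lam θ) (t : ℕ) (i : Fin n) :
    1 / phi A t i ≤ θ := by
  rw [one_div]
  exact inv_le_of_inv_le₀ hC.θ_pos (hC.phi_lower t i)

/-- Jensen's inequality for each row of `𝓑_t`, followed by `sum_phi_mul_mix`: this is why the energy
carries the weights `phi`. -/
lemma sum_phi_mul_average_sq_le (hA : NetworkAssumption A γ B) (hγ : 0 < γ) (t : ℕ)
    (x : Fin n → E m) (u : E m) :
    ∑ i, phi A (t + 1) i * ‖average A t x i - u‖ ^ 2 ≤ energy A t x u := by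
  have hconv : ConvexOn ℝ Set.univ fun v : E m => ‖v‖ ^ 2 :=
    convexOn_univ_norm.pow (fun _ _ => norm_nonneg _) 2
  have h1 : ∀ i, ‖average A t x i - u‖ ^ 2 ≤ ∑ j, mix A t i j * ‖x j - u‖ ^ 2 := fun i => by
    have h := hconv.map_sum_le (t := Finset.univ) (w := fun j => mix A t i j)
      (p := fun j => x j - u) (fun j _ => hA.mix_nonneg hγ t i j) (hA.sum_mix hγ t i)
      fun _ _ => Set.mem_univ _
    simp only [smul_sub, Finset.sum_sub_distrib, ← Finset.sum_smul, hA.sum_mix hγ t i, one_smul,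
      smul_eq_mul] at h
    exact h
  calc ∑ i, phi A (t + 1) i * ‖average A t x i - u‖ ^ 2
      ≤ ∑ i, phi A (t + 1) i * ∑ j, mix A t i j * ‖x j - u‖ ^ 2 :=
        Finset.sum_le_sum fun i _ => mul_le_mul_of_nonneg_left (h1 i) (hA.phi_pos hγ _ i).le
    _ = ∑ j, (∑ i, phi A (t + 1) i * mix A t i j) * ‖x j - u‖ ^ 2 := by
        simp only [Finset.mul_sum, Finset.sum_mul, mul_assoc]
        exact Finset.sum_comm
    _ = _ := by simp only [hA.sum_phi_mul_mix hγ, energy]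

lemma stepSize_pos (hm : 1 ≤ m) (t : ℕ) : 0 < stepSize m t := by
  have : (0 : ℝ) < m := by exact_mod_cast hm
  unfold stepSize
  positivity

lemma energy_nonneg (hC : NetworkConstants A C lam θ) (t : ℕ) (x : Fin n → E m) (u : E m) :
    0 ≤ energy A t x u :=
  Finset.sum_nonneg fun i _ => mul_nonneg (hC.phi_pos t i).le (sq_nonneg _)

variable (hA : NetworkAssumption A γ B) (hγ : 0 < γ) (hC : NetworkConstants A C lam θ)
  (hf : CostAssumption Ω r R G f) (hm : 1 ≤ m) (hξ0 : 0 < ξ) (hξ1 : ξ ≤ 1)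
  (hx0 : ∀ i, x0 i ∈ (1 - ξ) • Ω) (hz : ∀ i t, ‖z i t‖ = 1)

include hA hγ hC hf hm hξ0 hξ1 hx0 hz

/-- One step of the algorithm decreases the energy, up to the size of the oracle. -/
lemma sum_inner_oracle_le {u : E m} (hu : u ∈ (1 - ξ) • Ω) (t : ℕ) :
    ∑ i, inner ℝ (oracle (f i t) (ξ * r) (decisions A Ω f (ξ * r) ξ (stepSize m) x0 z t i) (z i t))
        (average A t (decisions A Ω f (ξ * r) ξ (stepSize m) x0 z t) i - u)
      ≤ m * √((t : ℝ) + 1) / 2 *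
          (energy A t (decisions A Ω f (ξ * r) ξ (stepSize m) x0 z t) u
            - energy A (t + 1) (decisions A Ω f (ξ * r) ξ (stepSize m) x0 z (t + 1)) u)
        + n * m * θ * G ^ 2 / 2 * (1 / √((t : ℝ) + 1)) := by
  set x := decisions A Ω f (ξ * r) ξ (stepSize m) x0 z with hx
  set a := stepSize m t with ha
  have ha0 : 0 < a := stepSize_pos hm t
  have hm0 : (0 : ℝ) < m := by exact_mod_cast hm
  have hmem : ∀ i, x t i ∈ (1 - ξ) • Ω := hf.decisions_mem hx0 t
  set g : Fin n → E m := fun i => oracle (f i t) (ξ * r) (x t i) (z i t) with hg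
  set y : Fin n → E m := average A t (x t) with hy
  have hi : ∀ i, phi A (t + 1) i * ‖x (t + 1) i - u‖ ^ 2
      ≤ phi A (t + 1) i * ‖y i - u‖ ^ 2 - 2 * a * inner ℝ (g i) (y i - u)
        + a ^ 2 * θ * (m * G) ^ 2 := by
    intro i
    have hφ := hC.phi_pos (t + 1) i
    have h1 : ‖x (t + 1) i - u‖ ≤ ‖y i - (1 / phi A (t + 1) i * a) • g i - u‖ := by
      rw [hx, decisions_succ]
      exact norm_proj_sub_le hf.shrink_nonempty hf.isClosed_shrink hf.convex_shrink hu _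
    have h2 : ‖y i - (1 / phi A (t + 1) i * a) • g i - u‖ ^ 2
        = ‖y i - u‖ ^ 2 - 2 * ((1 / phi A (t + 1) i * a) * inner ℝ (g i) (y i - u))
          + (1 / phi A (t + 1) i * a) ^ 2 * ‖g i‖ ^ 2 := by
      rw [sub_right_comm, norm_sub_sq_real, real_inner_smul_right, norm_smul, mul_pow,
        Real.norm_eq_abs, sq_abs, real_inner_comm]
    have h3 : ‖g i‖ ^ 2 ≤ (m * G) ^ 2 :=
      pow_le_pow_left₀ (norm_nonneg _) (hf.norm_oracle_le i t hξ0 hξ1 (hmem i) (hz i t)) 2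
    calc phi A (t + 1) i * ‖x (t + 1) i - u‖ ^ 2
        ≤ phi A (t + 1) i * ‖y i - (1 / phi A (t + 1) i * a) • g i - u‖ ^ 2 := by gcongr
      -- The weight cancels the `1 / phi` of the step in the cross term, so the inner products are
      -- summed over nodes without weights.
      _ = phi A (t + 1) i * ‖y i - u‖ ^ 2 - 2 * a * inner ℝ (g i) (y i - u)
          + a ^ 2 * (1 / phi A (t + 1) i) * ‖g i‖ ^ 2 := by
        rw [h2]
        field_simp
      _ ≤ _ := by
        have := hC.inv_phi_le (t + 1) i
        have := hC.θ_pos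
        gcongr
  have hsum := Finset.sum_le_sum fun i (_ : i ∈ Finset.univ) => hi i
  rw [Finset.sum_add_distrib, Finset.sum_sub_distrib, ← Finset.mul_sum, Finset.sum_const,
    Finset.card_univ, Fintype.card_fin, nsmul_eq_mul] at hsum
  have hav := sum_phi_mul_average_sq_le hA hγ t (x t) u
  have hE : energy A (t + 1) (x (t + 1)) u ≤ energy A t (x t) u
      - 2 * a * ∑ i, inner ℝ (g i) (y i - u) + n * (a ^ 2 * θ * (m * G) ^ 2) := by
    unfold energy at hav ⊢
    linarith
  have hs : 0 < √((t : ℝ) + 1) := Real.sqrt_pos.2 (by positivity)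
  -- The multiplier is `1 / (2 a)`.
  have hw : m * √((t : ℝ) + 1) / 2 * (2 * a) = 1 := by
    rw [ha, stepSize]
    field_simp
  have hw' : m * √((t : ℝ) + 1) / 2 * (n * (a ^ 2 * θ * (m * G) ^ 2))
      = n * m * θ * G ^ 2 / 2 * (1 / √((t : ℝ) + 1)) := by
    rw [ha, stepSize]
    field_simp
  have hw0 : 0 ≤ m * √((t : ℝ) + 1) / 2 := by positivity
  have hfin := mul_le_mul_of_nonneg_left hE hw0
  have e : m * √((t : ℝ) + 1) / 2 * (energy A t (x t) u
      - 2 * a * ∑ i, inner ℝ (g i) (y i - u) + n * (a ^ 2 * θ * (m * G) ^ 2))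
      = m * √((t : ℝ) + 1) / 2 * energy A t (x t) u - ∑ i, inner ℝ (g i) (y i - u)
        + n * m * θ * G ^ 2 / 2 * (1 / √((t : ℝ) + 1)) := by
    rw [← hw']
    linear_combination (-∑ i, inner ℝ (g i) (y i - u)) * hw
  rw [e] at hfin
  rw [mul_sub]
  linarith

/-- The average already lies in the shrunk set, so projecting moves the new point no farther from it
than the step length; the `m` of the oracle bound cancels the `1 / m` in the step size. -/
lemma norm_decisions_succ_sub_average_le (t : ℕ) (i : Fin n) :
    ‖decisions A Ω f (ξ * r) ξ (stepSize m) x0 z (t + 1) i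
        - average A t (decisions A Ω f (ξ * r) ξ (stepSize m) x0 z t) i‖
      ≤ θ * G * (1 / √((t : ℝ) + 1)) := by
  set x := decisions A Ω f (ξ * r) ξ (stepSize m) x0 z with hx
  have hmem : ∀ i, x t i ∈ (1 - ξ) • Ω := hf.decisions_mem hx0 t
  have hm0 : (0 : ℝ) < m := by exact_mod_cast hm
  have hy := average_mem hA hγ hf.convex_shrink hmem t i
  have h1 := norm_proj_sub_le hf.shrink_nonempty hf.isClosed_shrink hf.convex_shrink hy
    (average A t (x t) i - (1 / phi A (t + 1) i * stepSize m t) •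
      oracle (f i t) (ξ * r) (x t i) (z i t))
  rw [← decisions_succ, sub_sub_cancel_left, norm_neg, norm_smul] at h1
  refine h1.trans ?_
  have ha0 := stepSize_pos hm t
  have hφ := hC.phi_pos (t + 1) i
  rw [Real.norm_of_nonneg (by positivity)]
  have hθ := hC.θ_pos
  calc 1 / phi A (t + 1) i * stepSize m t * ‖oracle (f i t) (ξ * r) (x t i) (z i t)‖
      ≤ θ * stepSize m t * (m * G) := by
        have h2 := hC.inv_phi_le (t + 1) i
        have h3 := hf.norm_oracle_le i t hξ0 hξ1 (hmem i) (hz i t)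
        gcongr
    _ = _ := by
      rw [stepSize]
      field_simp

lemma exists_disagreement_le (T : ℕ) : ∃ d : ℕ → ℝ,
    (∀ t i j, ‖decisions A Ω f (ξ * r) ξ (stepSize m) x0 z t i
      - decisions A Ω f (ξ * r) ξ (stepSize m) x0 z t j‖ ≤ 2 * d t) ∧
    (∀ t i, ‖average A t (decisions A Ω f (ξ * r) ξ (stepSize m) x0 z t) i
      - decisions A Ω f (ξ * r) ξ (stepSize m) x0 z t i‖ ≤ 2 * d t) ∧
    ∑ t ∈ Finset.range (T + 1), d t
      ≤ C / (1 - lam) * (∑ i, ‖x0 i‖ + 2 * n * θ * G * √((T : ℝ) + 1)) := by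
  set x := decisions A Ω f (ξ * r) ξ (stepSize m) x0 z with hx
  have hθ := hC.θ_pos
  have hG := hf.G_pos
  obtain ⟨c, hc⟩ := hC.exists_center (x := x) (e := fun t i => x (t + 1) i - average A t (x t) i)
    (ε := fun t => θ * G * (1 / √((t : ℝ) + 1))) (fun t i => by simp)
    (norm_decisions_succ_sub_average_le hA hγ hC hf hm hξ0 hξ1 hx0 hz)
  refine ⟨_, fun t i j => ?_, fun t i => ?_,
    (hC.sum_disagreement_le (S := ∑ i, ‖x 0 i‖) (by positivity)
      (ε := fun t => θ * G * (1 / √((t : ℝ) + 1))) (fun t => by positivity) (T + 1)).trans ?_⟩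
  · have h := norm_sub_le_norm_sub_add_norm_sub (x t i) (c t) (x t j)
    rw [norm_sub_rev (c t)] at h
    linarith [hc t i, hc t j]
  · have h := norm_sub_le_norm_sub_add_norm_sub (average A t (x t) i) (c t) (x t i)
    rw [norm_sub_rev (c t)] at h
    linarith [hc t i, norm_average_sub_le hA hγ (hc t) t i]
  · have h1 := sum_inv_sqrt_le (T + 1)
    push_cast at h1
    have h2 : 0 < 1 - lam := by linarith [hC.lam_lt_one]
    have h3 := hC.C_pos
    rw [← Finset.mul_sum]
    calc (C * ∑ i, ‖x 0 i‖ + C * n * (θ * G * ∑ t ∈ Finset.range (T + 1), 1 / √((t : ℝ) + 1)))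
          / (1 - lam)
        ≤ (C * ∑ i, ‖x 0 i‖ + C * n * (θ * G * (2 * √((T : ℝ) + 1)))) / (1 - lam) := by gcongr
      _ = C / (1 - lam) * (∑ i, ‖x 0 i‖ + 2 * n * θ * G * √((T : ℝ) + 1)) := by ring

omit hm hξ0 hγ hz in
-- A difference of squares is difference times sum: at most `‖xs (t + 1) - xs t‖` times `4 R`. The
-- weights `phi` add up to `n`.
lemma energy_shift_le (hxs : ∀ t, xs t ∈ Ω) (hξ0 : 0 ≤ ξ) (t : ℕ) :
    energy A (t + 1) (decisions A Ω f (ξ * r) ξ (stepSize m) x0 z (t + 1))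
        ((1 - ξ) • xs (t + 1))
      ≤ energy A (t + 1) (decisions A Ω f (ξ * r) ξ (stepSize m) x0 z (t + 1)) ((1 - ξ) • xs t)
        + 4 * n * R * ‖xs (t + 1) - xs t‖ := by
  set x := decisions A Ω f (ξ * r) ξ (stepSize m) x0 z (t + 1) with hx
  have hR := hf.R_pos
  have hmem : ∀ i, x i ∈ Ω := fun i => hf.shrink_subset hξ0 hξ1 (hf.decisions_mem hx0 _ i)
  have hu : ∀ s, (1 - ξ) • xs s ∈ Ω := fun s =>
    hf.shrink_subset hξ0 hξ1 (Set.smul_mem_smul_set (hxs s))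
  have hi : ∀ i, ‖x i - (1 - ξ) • xs (t + 1)‖ ^ 2
      ≤ ‖x i - (1 - ξ) • xs t‖ ^ 2 + 4 * R * ‖xs (t + 1) - xs t‖ := by
    intro i
    have h1 : ‖x i - (1 - ξ) • xs (t + 1)‖ ≤ 2 * R := by
      linarith [norm_sub_le (x i) ((1 - ξ) • xs (t + 1)), hf.norm_le (hmem i),
        hf.norm_le (hu (t + 1))]
    have h2 : ‖x i - (1 - ξ) • xs t‖ ≤ 2 * R := by
      linarith [norm_sub_le (x i) ((1 - ξ) • xs t), hf.norm_le (hmem i), hf.norm_le (hu t)]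
    have h3 : ‖x i - (1 - ξ) • xs (t + 1)‖ ≤ ‖x i - (1 - ξ) • xs t‖ + ‖xs (t + 1) - xs t‖ := by
      have h := norm_sub_le_norm_sub_add_norm_sub (x i) ((1 - ξ) • xs t) ((1 - ξ) • xs (t + 1))
      rw [← smul_sub, norm_smul, Real.norm_of_nonneg (by linarith), norm_sub_rev (xs t)] at h
      nlinarith [norm_nonneg (xs (t + 1) - xs t)]
    have h4 := norm_nonneg (x i - (1 - ξ) • xs (t + 1))
    have h5 := norm_nonneg (x i - (1 - ξ) • xs t)
    have h6 := norm_nonneg (xs (t + 1) - xs t)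
    nlinarith [mul_nonneg (sub_nonneg.2 h3) (add_nonneg h4 h5),
      mul_nonneg h6 (sub_nonneg.2 (add_le_add h1 h2))]
  calc energy A (t + 1) x ((1 - ξ) • xs (t + 1))
      ≤ ∑ i, phi A (t + 1) i * (‖x i - (1 - ξ) • xs t‖ ^ 2 + 4 * R * ‖xs (t + 1) - xs t‖) :=
        Finset.sum_le_sum fun i _ => mul_le_mul_of_nonneg_left (hi i) (hC.phi_pos _ i).le
    _ = _ := by
      simp only [mul_add, Finset.sum_add_distrib, ← Finset.sum_mul, hA.sum_phi, energy]
      ring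

omit hm hξ0 hγ hz in
lemma energy_le (hxs : ∀ t, xs t ∈ Ω) (hξ0 : 0 ≤ ξ) (t : ℕ) :
    energy A t (decisions A Ω f (ξ * r) ξ (stepSize m) x0 z t) ((1 - ξ) • xs t)
      ≤ 4 * n * R ^ 2 := by
  set x := decisions A Ω f (ξ * r) ξ (stepSize m) x0 z t with hx
  have hi : ∀ i, ‖x i - (1 - ξ) • xs t‖ ^ 2 ≤ (2 * R) ^ 2 := fun i => by
    refine pow_le_pow_left₀ (norm_nonneg _) ?_ 2
    have hmem : x i ∈ Ω := hf.shrink_subset hξ0 hξ1 (hf.decisions_mem hx0 t i)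
    linarith [norm_sub_le (x i) ((1 - ξ) • xs t), hf.norm_le hmem,
      hf.norm_le (hf.shrink_subset hξ0 hξ1 (Set.smul_mem_smul_set (a := 1 - ξ) (hxs t)))]
  calc energy A t x ((1 - ξ) • xs t) ≤ ∑ i, phi A t i * (2 * R) ^ 2 :=
        Finset.sum_le_sum fun i _ => mul_le_mul_of_nonneg_left (hi i) (hC.phi_pos _ i).le
    _ = _ := by
      rw [← Finset.sum_mul, hA.sum_phi]
      ring

/-- The instantaneous regret of node `j`. -/
lemma globalCost_sub_add_gap_le (hxs : ∀ t, xs t ∈ Ω) (t : ℕ) (j : Fin n) {d : ℝ}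
    (hd : ∀ i j, ‖decisions A Ω f (ξ * r) ξ (stepSize m) x0 z t i
      - decisions A Ω f (ξ * r) ξ (stepSize m) x0 z t j‖ ≤ 2 * d)
    (hd' : ∀ i, ‖average A t (decisions A Ω f (ξ * r) ξ (stepSize m) x0 z t) i
      - decisions A Ω f (ξ * r) ξ (stepSize m) x0 z t i‖ ≤ 2 * d) :
    globalCost f t (decisions A Ω f (ξ * r) ξ (stepSize m) x0 z t j) - globalCost f t (xs t)
      + ∑ i, oracleGap A f (ξ * r) G t i ((1 - ξ) • xs t)
          (decisions A Ω f (ξ * r) ξ (stepSize m) x0 z t) (z i t)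
      ≤ m * √((t : ℝ) + 1) / 2 *
          (energy A t (decisions A Ω f (ξ * r) ξ (stepSize m) x0 z t) ((1 - ξ) • xs t)
            - energy A (t + 1) (decisions A Ω f (ξ * r) ξ (stepSize m) x0 z (t + 1))
                ((1 - ξ) • xs t))
        + n * m * θ * G ^ 2 / 2 * (1 / √((t : ℝ) + 1))
        + n * G * (r + R) * ξ + 4 * n * G * d := by
  have hu : (1 - ξ) • xs t ∈ (1 - ξ) • Ω := Set.smul_mem_smul_set (hxs t)
  have hmain := sum_inner_oracle_le hA hγ hC hf hm hξ0 hξ1 hx0 hz hu t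
  set x := decisions A Ω f (ξ * r) ξ (stepSize m) x0 z with hx
  have hG := hf.G_pos
  have hmem : ∀ i, x t i ∈ Ω := fun i => hf.shrink_subset hξ0.le hξ1 (hf.decisions_mem hx0 t i)
  have hi : ∀ i, f i t (x t j) - f i t (xs t)
      + oracleGap A f (ξ * r) G t i ((1 - ξ) • xs t) (x t) (z i t)
      ≤ inner ℝ (oracle (f i t) (ξ * r) (x t i) (z i t)) (average A t (x t) i - (1 - ξ) • xs t)
        + (G * (r + R) * ξ + 4 * G * d) := by
    intro i
    have h1 : f i t (x t j) - f i t (x t i) ≤ G * (2 * d) :=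
      (hf.sub_le i t (hmem j) (hmem i)).trans (mul_le_mul_of_nonneg_left (hd j i) hG.le)
    have h2 : f i t ((1 - ξ) • xs t) - f i t (xs t) ≤ G * (ξ * R) := by
      refine (hf.sub_le i t (hf.shrink_subset hξ0.le hξ1 hu) (hxs t)).trans
        (mul_le_mul_of_nonneg_left ?_ hG.le)
      rw [sub_smul, one_smul, sub_sub_cancel_left, norm_neg, norm_smul,
        Real.norm_of_nonneg hξ0.le]
      exact mul_le_mul_of_nonneg_left (hf.norm_le (hxs t)) hξ0.le
    have h3 := mul_le_mul_of_nonneg_left (hd' i) hG.le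
    unfold oracleGap
    linarith
  have hsum := Finset.sum_le_sum fun i (_ : i ∈ Finset.univ) => hi i
  simp only [Finset.sum_add_distrib, Finset.sum_sub_distrib, Finset.sum_const, Finset.card_univ,
    Fintype.card_fin, nsmul_eq_mul] at hsum
  unfold globalCost
  linarith

/-- The regret along one realization of the noise, up to a sum of mean-nonnegative terms. -/
lemma dynamicRegret_add_gap_le (hxs : ∀ t, xs t ∈ Ω) (T : ℕ) (j : Fin n)
    (hξT : ξ * ((T : ℝ) + 1) = √((T : ℝ) + 1)) :
    dynamicRegret f xs (decisions A Ω f (ξ * r) ξ (stepSize m) x0 z) T j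
      + ∑ t ∈ Finset.range (T + 1), ∑ i, oracleGap A f (ξ * r) G t i ((1 - ξ) • xs t)
          (decisions A Ω f (ξ * r) ξ (stepSize m) x0 z t) (z i t)
      ≤ K₁ n m R G (G / R) C lam θ (∑ i, ‖x0 i‖)
        + K₂ n m r R G (G / R) C lam θ (pathVariation xs T) * √((T : ℝ) + 1) := by
  obtain ⟨d, hd, hd', hdsum⟩ := exists_disagreement_le hA hγ hC hf hm hξ0 hξ1 hx0 hz T
  have hstep := Finset.sum_le_sum fun t (_ : t ∈ Finset.range (T + 1)) =>
    globalCost_sub_add_gap_le hA hγ hC hf hm hξ0 hξ1 hx0 hz hxs t j (hd t) (hd' t)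
  -- The increasing weights are `1 / (2 α_t)`; `a` and `b` are the energies before and after step
  -- `t` for the same comparison point, and `v` pays for moving on to the next one.
  have habel := sum_mul_sub_le (w := fun t : ℕ => m * √((t : ℝ) + 1) / 2)
    (M := 4 * n * R ^ 2) (v := fun t => 4 * n * R * ‖xs (t + 1) - xs t‖)
    (a := fun t => energy A t (decisions A Ω f (ξ * r) ξ (stepSize m) x0 z t) ((1 - ξ) • xs t))
    (b := fun t => energy A (t + 1) (decisions A Ω f (ξ * r) ξ (stepSize m) x0 z (t + 1))
      ((1 - ξ) • xs t))
    (fun t => by positivity) (fun s t hst => by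
      have : (s : ℝ) ≤ t := by exact_mod_cast hst
      dsimp only
      gcongr)
    (energy_le hA hC hf hξ1 hx0 hxs hξ0.le)
    (fun t => energy_nonneg hC _ _ _)
    (fun t => by have := hf.R_pos; positivity)
    (energy_shift_le hA hC hf hξ1 hx0 hxs hξ0.le) T
  simp only [Finset.sum_add_distrib, Finset.sum_sub_distrib, Finset.sum_const, Finset.card_range,
    nsmul_eq_mul, ← Finset.mul_sum] at hstep
  rw [← Finset.mul_sum, ← pathVariation] at habel
  have hinv := sum_inv_sqrt_le (T + 1)
  push_cast at hinv hstep
  have hS : ∑ i, ‖x0 i‖ ≤ n * R := by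
    refine (Finset.sum_le_sum fun i _ =>
      hf.norm_le (hf.shrink_subset hξ0.le hξ1 (hx0 i))).trans (le_of_eq ?_)
    simp
  have hθ := hC.one_le_θ j
  have hS0 : 0 ≤ ∑ i, ‖x0 i‖ := by positivity
  have hV0 : 0 ≤ pathVariation xs T := Finset.sum_nonneg fun _ _ => norm_nonneg _
  have hl0 := hC.lam_pos
  have hl1 := hC.lam_lt_one
  have hC0 := hC.C_pos
  have hG := hf.G_pos
  have hR := hf.R_pos
  have hr := hf.r_pos
  have hm1 : (1 : ℝ) ≤ m := by exact_mod_cast hm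
  have hq : 0 ≤ √((T : ℝ) + 1) := Real.sqrt_nonneg _
  unfold dynamicRegret
  generalize √((T : ℝ) + 1) = q at *
  generalize pathVariation xs T = V at *
  generalize ∑ i, ‖x0 i‖ = S at *
  generalize (∑ t ∈ Finset.range (T + 1), 1 / √((t : ℝ) + 1)) = Q at *
  have hN0 : (0 : ℝ) ≤ n := Nat.cast_nonneg n
  have hP : 0 < C / (1 - lam) := div_pos hC0 (by linarith)
  have e1 : K₁ n m R G (G / R) C lam θ S
      = C / (1 - lam) * (n * G * (2 * θ + 2 * m * θ * lam + 1) * S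
      + 2 * n ^ 2 * θ * G * R / lam) := by
    unfold K₁
    have : 1 - lam ≠ 0 := by linarith
    field_simp
  have e2 : K₂ n m r R G (G / R) C lam θ V = C / (1 - lam) *
      (2 * n ^ 2 * θ * G ^ 2 * (2 * θ + 2 * m * θ + 1))
      + n * m * θ ^ 2 * G ^ 2 + 2 * n * m * R ^ 2 + n * r * θ * G + n * θ * G * R
      + 2 * n * m * R * V := by
    unfold K₂
    have : 1 - lam ≠ 0 := by linarith
    field_simp
  rw [e1, e2]
  generalize C / (1 - lam) = p at *
  have b1 : n * m * θ * G ^ 2 / 2 * Q ≤ n * m * θ ^ 2 * G ^ 2 * q := by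
    calc n * m * θ * G ^ 2 / 2 * Q ≤ n * m * θ * G ^ 2 / 2 * (2 * q) := by gcongr
      _ = n * m * (θ * 1) * G ^ 2 * q := by ring
      _ ≤ n * m * (θ * θ) * G ^ 2 * q := by gcongr
      _ = _ := by ring
  have b2 : ((T : ℝ) + 1) * (n * G * (r + R) * ξ) ≤ (n * r * θ * G + n * θ * G * R) * q := by
    calc ((T : ℝ) + 1) * (n * G * (r + R) * ξ) = n * G * (r + R) * (ξ * ((T : ℝ) + 1)) := by ring
      _ = 1 * (n * G * (r + R) * q) := by rw [hξT]; ring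
      _ ≤ θ * (n * G * (r + R) * q) := by gcongr
      _ = _ := by ring
  have b3 : 4 * n * G * ∑ t ∈ Finset.range (T + 1), d t
      ≤ p * (4 * n * G * S) + p * (8 * n ^ 2 * θ * G ^ 2) * q := by
    refine (mul_le_mul_of_nonneg_left hdsum (by positivity)).trans (le_of_eq ?_)
    ring
  -- Of the coefficient `4`, three units fit into the first term because `θ ≥ 1`; the last is
  -- absorbed by the second because `S ≤ n * R` and `lam < 1`.
  have b4 : 4 * n * G * S ≤ n * G * (2 * θ + 2 * m * θ * lam + 1) * S
      + 2 * n ^ 2 * θ * G * R / lam := by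
    have h1 : n * G * 3 * S ≤ n * G * (2 * θ + 2 * m * θ * lam + 1) * S := by
      have : 0 ≤ 2 * m * θ * lam := by positivity
      gcongr
      linarith
    have h2 : n * G * S ≤ 2 * n ^ 2 * θ * G * R / lam := by
      rw [le_div_iff₀ hl0]
      calc n * G * S * lam ≤ n * G * (n * R) * 1 := by gcongr
        _ = 1 * (n ^ 2 * G * R) := by ring
        _ ≤ (2 * θ) * (n ^ 2 * G * R) := by gcongr; linarith
        _ = _ := by ring
    linarith
  have b5 : 8 * n ^ 2 * θ * G ^ 2 ≤ 2 * n ^ 2 * θ * G ^ 2 * (2 * θ + 2 * m * θ + 1) := by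
    have : 1 ≤ m * θ := one_le_mul_of_one_le_of_one_le hm1 hθ
    calc 8 * n ^ 2 * θ * G ^ 2 = 2 * n ^ 2 * θ * G ^ 2 * 4 := by ring
      _ ≤ _ := by gcongr; linarith
  have b6 := mul_le_mul_of_nonneg_left b4 hP.le
  have b7 := mul_le_mul_of_nonneg_right (mul_le_mul_of_nonneg_left b5 hP.le) hq
  linarith

end Pathwise

/-! ### Averaging over the noise -/

section Noise

variable {n m : ℕ} {A : ℕ → Matrix (Fin n) (Fin n) ℝ} {γ : ℝ} {B : ℕ} {C lam θ : ℝ}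
  {Ω : Set (E m)} {r R G ξ μ : ℝ} {f : Fin n → ℕ → E m → ℝ} {xs : ℕ → E m} {x0 : Fin n → E m}
  {α : ℕ → ℝ} {S : Type*} [MeasurableSpace S] {P : Measure S} [IsProbabilityMeasure P]
  {ζ : Fin n → ℕ → S → Metric.sphere (0 : E m) 1}

/-- Extend finitely many directions by zero. -/
noncomputable def extendNoise (s : Finset (Fin n × ℕ)) (v : s → Metric.sphere (0 : E m) 1) :
    Fin n → ℕ → E m :=
  fun i t => if h : (i, t) ∈ s then (v ⟨(i, t), h⟩ : E m) else 0

lemma continuous_extendNoise (s : Finset (Fin n × ℕ)) :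
    Continuous (extendNoise (m := m) s) := by
  refine continuous_pi fun i => continuous_pi fun t => ?_
  unfold extendNoise
  split_ifs
  · exact continuous_subtype_val.comp (continuous_apply _)
  · exact continuous_const

omit [MeasurableSpace S] in
lemma decisions_extendNoise (t : ℕ) (ω : S) :
    decisions A Ω f μ ξ α x0 (extendNoise (Finset.univ ×ˢ Finset.range t)
        fun p => ζ p.1.1 p.1.2 ω) t
      = decisions A Ω f μ ξ α x0 (fun i s => (ζ i s ω : E m)) t :=
  decisions_eq_of_noise_eq t fun i s hs => by simp [extendNoise, hs]

lemma CostAssumption.measurable_decisions_extendNoise (hf : CostAssumption Ω r R G f)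
    (hc : ∀ i t, Continuous (f i t)) (s : Finset (Fin n × ℕ)) (t : ℕ) :
    Measurable fun v => decisions A Ω f μ ξ α x0 (extendNoise (m := m) s v) t :=
  ((hf.continuous_decisions hc t).comp (continuous_extendNoise s)).measurable

omit [IsProbabilityMeasure P] in
lemma CostAssumption.aemeasurable_decisions (hf : CostAssumption Ω r R G f)
    (hc : ∀ i t, Continuous (f i t)) (hζ : IsUniformNoise P ζ) (t : ℕ) :
    AEMeasurable (fun ω => decisions A Ω f μ ξ α x0 (fun i s => (ζ i s ω : E m)) t) P := by
  simp only [← decisions_extendNoise]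
  exact (hf.measurable_decisions_extendNoise hc _ t).comp_aemeasurable
    (aemeasurable_pi_lambda _ fun p => (hζ.law p.1.1 p.1.2).aemeasurable)

omit [IsProbabilityMeasure P] in
/-- The decisions at time `t` are independent of the noise at time `t`. -/
lemma CostAssumption.indepFun_decisions (hf : CostAssumption Ω r R G f)
    (hc : ∀ i t, Continuous (f i t)) (hζ : IsUniformNoise P ζ) (t : ℕ) (i : Fin n) :
    IndepFun (fun ω => decisions A Ω f μ ξ α x0 (fun i s => (ζ i s ω : E m)) t) (ζ i t) P := by
  -- The pairs with time before `t` and the single pair `(i, t)` are disjoint index sets.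
  have h := hζ.indep.indepFun_finset₀ (Finset.univ ×ˢ Finset.range t) {(i, t)}
    (by simp) fun p => (hζ.law p.1 p.2).aemeasurable
  have hψ : Measurable fun v : ({(i, t)} : Finset (Fin n × ℕ)) → Metric.sphere (0 : E m) 1 =>
      v ⟨(i, t), by simp⟩ := measurable_pi_apply _
  have h' := h.comp
    (φ := fun v => decisions A Ω f μ ξ α x0 (extendNoise (m := m) _ v) t)
    (hf.measurable_decisions_extendNoise hc _ t) hψ
  convert h' using 1
  · funext ω
    exact (decisions_extendNoise t ω).symm
  · rfl

variable (hf : CostAssumption Ω r R G f) (hc : ∀ i t, Continuous (f i t))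
  (hζ : IsUniformNoise P ζ) (hx0 : ∀ i, x0 i ∈ (1 - ξ) • Ω)

include hf hc hζ hx0

lemma integrable_comp_decisions {H : (Fin n → E m) × Metric.sphere (0 : E m) 1 → ℝ}
    (hH : Continuous H) (t : ℕ) (i : Fin n) :
    Integrable (fun ω =>
      H (decisions A Ω f μ ξ α x0 (fun i s => (ζ i s ω : E m)) t, ζ i t ω)) P := by
  have hcpt : IsCompact ((Set.univ.pi fun _ : Fin n => (1 - ξ) • Ω) ×ˢ
      (Set.univ : Set (Metric.sphere (0 : E m) 1))) :=
    (isCompact_univ_pi fun _ => hf.isCompact_shrink).prod isCompact_univ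
  obtain ⟨M, hM⟩ := hcpt.exists_bound_of_continuousOn hH.continuousOn
  refine Integrable.of_bound (C := M) ?_ (ae_of_all _ fun ω => hM _ ⟨fun i _ => ?_, Set.mem_univ _⟩)
  · exact (hH.measurable.comp_aemeasurable
      ((hf.aemeasurable_decisions hc hζ t).prodMk (hζ.law i t).aemeasurable)).aestronglyMeasurable
  · exact hf.decisions_mem hx0 t i

/-- By independence the joint law is a product, so Fubini allows integrating over the fresh
direction with the decisions frozen at a point of the shrunk set. -/
lemma integral_comp_decisions_nonneg (hm : 1 ≤ m)
    {H : (Fin n → E m) × Metric.sphere (0 : E m) 1 → ℝ}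
    (hH : Continuous H) (t : ℕ) (i : Fin n)
    (hpos : ∀ x : Fin n → E m, (∀ i, x i ∈ (1 - ξ) • Ω) → 0 ≤ ∫ v, H (x, v) ∂uniformSphere m) :
    0 ≤ ∫ ω, H (decisions A Ω f μ ξ α x0 (fun i s => (ζ i s ω : E m)) t, ζ i t ω) ∂P := by
  have := isProbabilityMeasure_uniformSphere hm
  set X : S → Fin n → E m := fun ω =>
    decisions A Ω f μ ξ α x0 (fun i s => (ζ i s ω : E m)) t with hX
  have hXm : AEMeasurable X P := hf.aemeasurable_decisions hc hζ t
  have hζm := (hζ.law i t).aemeasurable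
  have hmap := (indepFun_iff_map_prod_eq_prod_map_map hXm hζm).1
    (hf.indepFun_decisions (A := A) (μ := μ) (α := α) (x0 := x0) (ξ := ξ) hc hζ t i)
  rw [(hζ.law i t).map_eq] at hmap
  have hpair := hXm.prodMk hζm
  have hint : Integrable H ((P.map X).prod (uniformSphere m)) := by
    rw [← hmap, integrable_map_measure hH.aestronglyMeasurable hpair]
    exact integrable_comp_decisions hf hc hζ hx0 hH t i
  rw [← integral_map (φ := fun ω => (X ω, ζ i t ω)) hpair hH.aestronglyMeasurable, hmap,
    integral_prod H hint]
  refine integral_nonneg_of_ae ?_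
  have hK : MeasurableSet {x : Fin n → E m | ∀ i, x i ∈ (1 - ξ) • Ω} := by
    have : {x : Fin n → E m | ∀ i, x i ∈ (1 - ξ) • Ω} = Set.univ.pi fun _ => (1 - ξ) • Ω := by
      ext; simp
    rw [this]
    exact (isClosed_set_pi fun _ _ => hf.isClosed_shrink).measurableSet
  have hmem : ∀ᵐ x ∂P.map X, ∀ i, x i ∈ (1 - ξ) • Ω :=
    (ae_map_iff hXm hK).2 (ae_of_all _ fun ω => hf.decisions_mem hx0 t)
  filter_upwards [hmem] with x hx
  exact hpos x hx

omit hf hζ hx0 in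
lemma continuous_oracleGap (t : ℕ) (i : Fin n) (u : E m) :
    Continuous fun p : (Fin n → E m) × Metric.sphere (0 : E m) 1 =>
      oracleGap A f μ G t i u p.1 (p.2 : E m) := by
  have h1 : Continuous fun p : (Fin n → E m) × Metric.sphere (0 : E m) 1 => average A t p.1 i :=
    (continuous_average t i).comp continuous_fst
  have h2 : Continuous fun p : (Fin n → E m) × Metric.sphere (0 : E m) 1 => p.1 i :=
    (continuous_apply i).comp continuous_fst
  have h3 : Continuous fun p : (Fin n → E m) × Metric.sphere (0 : E m) 1 =>
      oracle (f i t) μ (p.1 i) (p.2 : E m) :=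
    (continuous_oracle (hc i t)).comp (h2.prodMk (continuous_subtype_val.comp continuous_snd))
  unfold oracleGap
  exact (h3.inner (h1.sub continuous_const)).sub
    (((((hc i t).comp h2).sub continuous_const).sub continuous_const).sub
      (continuous_const.mul (h1.sub h2).norm))

omit hx0 hc hζ in
-- Writing `average - u` as `(x i - u) - (x i - average)`, the first part is handled by
-- `le_integral_inner_oracle` and the second by `integral_inner_oracle_le`.
lemma integral_oracleGap_nonneg (hm : 1 ≤ m)
    (hL : ∀ i t, LipschitzWith (Real.toNNReal G) (f i t)) (hξ0 : 0 < ξ) (hξ1 : ξ ≤ 1) (t : ℕ)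
    (i : Fin n) {u : E m} (hu : u ∈ (1 - ξ) • Ω) {x : Fin n → E m}
    (hx : ∀ i, x i ∈ (1 - ξ) • Ω) :
    0 ≤ ∫ v, oracleGap A f (ξ * r) G t i u x (v : E m) ∂uniformSphere m := by
  have := isProbabilityMeasure_uniformSphere hm
  have hμ : 0 < ξ * r := mul_pos hξ0 hf.r_pos
  have hG : ((Real.toNNReal G : NNReal) : ℝ) = G := Real.coe_toNNReal _ hf.G_pos.le
  obtain ⟨g, hg, -⟩ := hf.bounded_subgradient i t (x i) (hf.shrink_subset hξ0.le hξ1 (hx i))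
  have h1 := le_integral_inner_oracle hm (hL i t) hμ (hf.convex_cost i t)
    (fun v hv => hf.add_smul_mem hξ0.le hξ1 (hx i) hv)
    (fun v hv => hf.add_smul_mem hξ0.le hξ1 hu hv) hg
  have h2 := integral_inner_oracle_le hm (hL i t) hμ (x i) (x i - average A t x i)
  rw [hG] at h1 h2
  rw [norm_sub_rev] at h2
  have hint : ∀ w : E m, Integrable (fun v : Metric.sphere (0 : E m) 1 =>
      inner ℝ (oracle (f i t) (ξ * r) (x i) (v : E m)) w) (uniformSphere m) := fun w => by
    have hcont : Continuous fun v : Metric.sphere (0 : E m) 1 =>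
        inner ℝ (oracle (f i t) (ξ * r) (x i) (v : E m)) w :=
      ((continuous_oracle (hL i t).continuous).comp
        (continuous_const.prodMk continuous_subtype_val)).inner continuous_const
    exact hcont.integrable_of_hasCompactSupport (HasCompactSupport.of_compactSpace _)
  have h3 : ∫ v, oracleGap A f (ξ * r) G t i u x (v : E m) ∂uniformSphere m
      = ∫ v, inner ℝ (oracle (f i t) (ξ * r) (x i) (v : E m)) (x i - u) ∂uniformSphere m
        - ∫ v, inner ℝ (oracle (f i t) (ξ * r) (x i) (v : E m)) (x i - average A t x i)
            ∂uniformSphere m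
        - (f i t (x i) - f i t u - G * (ξ * r) - G * ‖average A t x i - x i‖) := by
    rw [← integral_sub (hint _) (hint _)]
    simp only [oracleGap, ← inner_sub_right, sub_sub_sub_cancel_left]
    rw [integral_sub (hint _) (integrable_const _), integral_const]
    simp
  rw [h3]
  linarith

end Noise

/-! ### The regret bound -/

section Regret

variable {n m : ℕ} {A : ℕ → Matrix (Fin n) (Fin n) ℝ} {γ : ℝ} {B : ℕ} {C lam θ : ℝ}
  {Ω : Set (E m)} {r R G : ℝ} {f : Fin n → ℕ → E m → ℝ} {xs : ℕ → E m} {x0 : Fin n → E m}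
  {S : Type*} [MeasurableSpace S] {P : Measure S} [IsProbabilityMeasure P]
  {ζ : Fin n → ℕ → S → Metric.sphere (0 : E m) 1}

lemma one_le_sqrt_succ (T : ℕ) : 1 ≤ √((T : ℝ) + 1) :=
  Real.one_le_sqrt.2 (by linarith [(Nat.cast_nonneg T : (0 : ℝ) ≤ T)])

lemma xiT_pos (T : ℕ) : 0 < xiT T :=
  div_pos one_pos (one_pos.trans_le (one_le_sqrt_succ T))

lemma xiT_le_one (T : ℕ) : xiT T ≤ 1 :=
  (div_le_one (one_pos.trans_le (one_le_sqrt_succ T))).2 (one_le_sqrt_succ T)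

lemma muT_eq (r : ℝ) (T : ℕ) : muT r T = xiT T * r := by
  rw [muT, xiT, one_div_mul_eq_div]

lemma xiT_mul (T : ℕ) : xiT T * ((T : ℝ) + 1) = √((T : ℝ) + 1) := by
  rw [xiT, one_div_mul_eq_div, Real.div_sqrt]

omit [MeasurableSpace S] in
lemma CostAssumption.algRegret_congr (hf : CostAssumption Ω r R G f)
    {f' : Fin n → ℕ → E m → ℝ} (h : ∀ i t, Set.EqOn (f i t) (f' i t) Ω) (hxs : ∀ t, xs t ∈ Ω)
    {T : ℕ} (hx0 : ∀ i, x0 i ∈ (1 - xiT T) • Ω) (j : Fin n) (ω : S) :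
    algRegret A Ω r f xs ζ x0 T j ω = algRegret A Ω r f' xs ζ x0 T j ω := by
  have hd := hf.decisions_congr (A := A) (α := stepSize m) (z := fun i t => (ζ i t ω : E m)) h
    (xiT_pos T).le (xiT_le_one T) hx0 fun i t => norm_eq_of_mem_sphere _
  have hF : ∀ t, ∀ x ∈ Ω, globalCost f t x = globalCost f' t x := fun t x hx =>
    Finset.sum_congr rfl fun i _ => h i t hx
  simp only [algRegret, dynamicRegret, muT_eq]
  congr 1
  · refine Finset.sum_congr rfl fun t _ => ?_
    rw [hd t, hF t _ (hf.shrink_subset (xiT_pos T).le (xiT_le_one T) (hf.decisions_mem hx0 t j))]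
  · exact Finset.sum_congr rfl fun t _ => hF t _ (hxs t)

omit [MeasurableSpace S] in
-- Minimality of `xs t` over `Ω` supplies the lower half of the squeeze for the average regret.
lemma CostAssumption.algRegret_nonneg (hf : CostAssumption Ω r R G f)
    (hxs : IsMinimizerSeq Ω f xs) {T : ℕ} (hx0 : ∀ i, x0 i ∈ (1 - xiT T) • Ω) (j : Fin n)
    (ω : S) : 0 ≤ algRegret A Ω r f xs ζ x0 T j ω :=
  sub_nonneg.2 (Finset.sum_le_sum fun t _ => (hxs t).2
    (hf.shrink_subset (xiT_pos T).le (xiT_le_one T) (hf.decisions_mem hx0 t j)))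

/-- The bound on the expected regret, for globally Lipschitz costs. -/
lemma integral_algRegret_le_of_lipschitz (hA : NetworkAssumption A γ B) (hγ : 0 < γ)
    (hC : NetworkConstants A C lam θ) (hm : 1 ≤ m) (hf : CostAssumption Ω r R G f)
    (hL : ∀ i t, LipschitzWith (Real.toNNReal G) (f i t)) (hxs : ∀ t, xs t ∈ Ω)
    (hζ : IsUniformNoise P ζ) (T : ℕ) (hx0 : ∀ i, x0 i ∈ (1 - xiT T) • Ω) (j : Fin n) :
    Integrable (algRegret A Ω r f xs ζ x0 T j) P ∧
      ∫ ω, algRegret A Ω r f xs ζ x0 T j ω ∂P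
        ≤ K₁ n m R G (G / R) C lam θ (∑ i, ‖x0 i‖)
          + K₂ n m r R G (G / R) C lam θ (pathVariation xs T) * √((T : ℝ) + 1) := by
  have hc : ∀ i t, Continuous (f i t) := fun i t => (hL i t).continuous
  have hξ0 := xiT_pos T
  have hξ1 := xiT_le_one T
  set X : S → ℕ → Fin n → E m := fun ω =>
    decisions A Ω f (xiT T * r) (xiT T) (stepSize m) x0 fun i t => (ζ i t ω : E m) with hX
  have hreg : algRegret A Ω r f xs ζ x0 T j = fun ω => dynamicRegret f xs (X ω) T j := by
    funext ω
    rw [algRegret, muT_eq]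
  have hint : Integrable (algRegret A Ω r f xs ζ x0 T j) P := by
    rw [hreg]
    refine (integrable_finsetSum _ fun t _ => ?_).sub (integrable_const _)
    refine integrable_comp_decisions hf hc hζ hx0 (H := fun p => globalCost f t (p.1 j)) ?_ t j
    exact continuous_finsetSum _ fun i _ =>
      (hc i t).comp ((continuous_apply j).comp continuous_fst)
  refine ⟨hint, ?_⟩
  have hgint : ∀ t i, Integrable (fun ω =>
      oracleGap A f (xiT T * r) G t i ((1 - xiT T) • xs t) (X ω t) (ζ i t ω : E m)) P :=
    fun t i => integrable_comp_decisions hf hc hζ hx0 (continuous_oracleGap hc t i _) t i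
  have hgpos : ∀ t i, 0 ≤ ∫ ω,
      oracleGap A f (xiT T * r) G t i ((1 - xiT T) • xs t) (X ω t) (ζ i t ω : E m) ∂P :=
    fun t i => integral_comp_decisions_nonneg hf hc hζ hx0 hm (continuous_oracleGap hc t i _) t i
      fun x hx => integral_oracleGap_nonneg hf hm hL hξ0 hξ1 t i
        (Set.smul_mem_smul_set (hxs t)) hx
  have hsint := integrable_finsetSum (Finset.range (T + 1)) fun t _ =>
    integrable_finsetSum Finset.univ fun i _ => hgint t i
  have hspos : 0 ≤ ∫ ω, ∑ t ∈ Finset.range (T + 1), ∑ i,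
      oracleGap A f (xiT T * r) G t i ((1 - xiT T) • xs t) (X ω t) (ζ i t ω : E m) ∂P := by
    rw [integral_finsetSum _ fun t _ => integrable_finsetSum Finset.univ fun i _ => hgint t i]
    refine Finset.sum_nonneg fun t _ => ?_
    rw [integral_finsetSum _ fun i _ => hgint t i]
    exact Finset.sum_nonneg fun i _ => hgpos t i
  have hle := integral_mono (hint.add hsint) (integrable_const _) fun ω => by
    simp only [Pi.add_apply, hreg]
    exact dynamicRegret_add_gap_le hA hγ hC hf hm hξ0 hξ1 hx0
      (z := fun i t => (ζ i t ω : E m)) (fun i t => norm_eq_of_mem_sphere _) hxs T j (xiT_mul T)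
  rw [integral_add' hint hsint, integral_const] at hle
  simp only [probReal_univ, one_smul] at hle
  linarith

/-- The bound on the expected regret. -/
theorem integral_algRegret_le (hA : NetworkAssumption A γ B) (hγ : 0 < γ)
    (hC : NetworkConstants A C lam θ) (hm : 1 ≤ m) (hf : CostAssumption Ω r R G f)
    (hxs : ∀ t, xs t ∈ Ω) (hζ : IsUniformNoise P ζ) (T : ℕ)
    (hx0 : ∀ i, x0 i ∈ (1 - xiT T) • Ω) (j : Fin n) :
    Integrable (algRegret A Ω r f xs ζ x0 T j) P ∧
      ∫ ω, algRegret A Ω r f xs ζ x0 T j ω ∂P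
        ≤ K₁ n m R G (G / R) C lam θ (∑ i, ‖x0 i‖)
          + K₂ n m r R G (G / R) C lam θ (pathVariation xs T) * √((T : ℝ) + 1) := by
  -- Decisions, queries and minimizers all lie in `Ω`, so the extended costs produce the same regret
  -- for every realization.
  obtain ⟨f', hL, h⟩ := hf.exists_lipschitz_extension
  rw [funext (hf.algRegret_congr (A := A) (ζ := ζ) h hxs hx0 j)]
  exact integral_algRegret_le_of_lipschitz hA hγ hC hm (hf.congr h) hL hxs hζ T hx0 j

/-! ### Monotonicity of the constants in `L` -/

lemma NetworkConstants.K₁_mono (hC : NetworkConstants A C lam θ) (hR : 0 ≤ R) (hG : 0 ≤ G)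
    {L L' s s' : ℝ} (hL0 : 0 ≤ L) (hL : L ≤ L') (hs0 : 0 ≤ s) (hs : s ≤ s') :
    K₁ n m R G L C lam θ s ≤ K₁ n m R G L' C lam θ s' := by
  have := hC.C_pos
  have := hC.θ_pos
  have := hC.lam_pos
  have : 0 < 1 - lam := by linarith [hC.lam_lt_one]
  have := hL0.trans hL
  unfold K₁
  gcongr

lemma NetworkConstants.K₂_mono (hC : NetworkConstants A C lam θ) (hR : 0 ≤ R) (hG : 0 ≤ G)
    {L L' V : ℝ} (hL : L ≤ L') :
    K₂ n m r R G L C lam θ V ≤ K₂ n m r R G L' C lam θ V := by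
  have := hC.C_pos
  have := hC.θ_pos
  have : 0 < 1 - lam := by linarith [hC.lam_lt_one]
  unfold K₂
  gcongr

/-- Since `μ ≤ r ≤ R` and `m ≥ 1`, the choice `L = G / R` gives the smaller constants. -/
lemma CostAssumption.div_R_le (hf : CostAssumption Ω r R G f) (hm : 1 ≤ m) (T : ℕ) :
    G / R ≤ m * G / muT r T := by
  have hm1 : (1 : ℝ) ≤ m := by exact_mod_cast hm
  have hμ : muT r T ≤ R := by
    rw [muT_eq]
    exact (mul_le_of_le_one_left hf.r_pos.le (xiT_le_one T)).trans (hf.r_le_R hm)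
  have hμ0 : 0 < muT r T := by
    rw [muT_eq]
    exact mul_pos (xiT_pos T) hf.r_pos
  have hG := hf.G_pos
  calc G / R ≤ G / muT r T := by gcongr
    _ ≤ m * G / muT r T := by
      gcongr
      exact le_mul_of_one_le_left hG.le hm1

/-- The average expected regret vanishes if the path variation is `o(√T)`. -/
theorem tendsto_integral_algRegret_div (hA : NetworkAssumption A γ B) (hγ : 0 < γ)
    (hC : NetworkConstants A C lam θ) (hm : 1 ≤ m) (hf : CostAssumption Ω r R G f)
    (hxs : IsMinimizerSeq Ω f xs) (hζ : IsUniformNoise P ζ)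
    (hV : (fun T : ℕ => pathVariation xs T) =o[atTop] (fun T : ℕ => √(T : ℝ)))
    {x0 : ℕ → Fin n → E m} (hx0 : ∀ T i, x0 T i ∈ (1 - xiT T) • Ω) (j : Fin n) :
    Tendsto (fun T : ℕ => (∫ ω, algRegret A Ω r f xs ζ (x0 T) T j ω ∂P) / (T : ℝ))
      atTop (nhds 0) := by
  have hR := hf.R_pos
  have hG := hf.G_pos
  have hr := hf.r_pos
  -- With `L = G / R` and initial points of norm at most `R`, both `a` and `b` are independent of
  -- the horizon; the path variation is split off from `K₂`.
  set a := K₁ n m R G (G / R) C lam θ (n * R)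
  set b := K₂ n m r R G (G / R) C lam θ 0 with hb
  have hb0 : 0 ≤ b := by
    have := hC.C_pos
    have := hC.θ_pos
    have : 0 < 1 - lam := by linarith [hC.lam_lt_one]
    rw [hb, K₂]
    positivity
  have hlim1 : Tendsto (fun T : ℕ => a / (T : ℝ)) atTop (nhds 0) :=
    tendsto_const_div_atTop_nhds_zero_nat a
  have hlim2 : Tendsto (fun T : ℕ => 2 * b * (√(T : ℝ))⁻¹) atTop (nhds 0) := by
    have h := (tendsto_inv_atTop_zero.comp
      (Real.tendsto_sqrt_atTop.comp tendsto_natCast_atTop_atTop)).const_mul (2 * b)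
    rw [mul_zero] at h
    exact h
  have hlim3 : Tendsto (fun T : ℕ => 4 * n * m * R * (pathVariation xs T / √(T : ℝ))) atTop
      (nhds 0) := by
    simpa using hV.tendsto_div_nhds_zero.const_mul (4 * n * m * R)
  have hlim := (hlim1.add hlim2).add hlim3
  simp only [add_zero] at hlim
  refine squeeze_zero' (Eventually.of_forall fun T => div_nonneg
    (integral_nonneg fun ω => hf.algRegret_nonneg hxs (hx0 T) j ω) (Nat.cast_nonneg T)) ?_ hlim
  filter_upwards [eventually_ge_atTop 1] with T hT
  have hT1 : (1 : ℝ) ≤ T := by exact_mod_cast hT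
  have hS : ∑ i, ‖x0 T i‖ ≤ n * R := by
    refine (Finset.sum_le_sum fun i _ => hf.norm_le
      (hf.shrink_subset (xiT_pos T).le (xiT_le_one T) (hx0 T i))).trans (le_of_eq ?_)
    simp
  have h1 := (integral_algRegret_le hA hγ hC hm hf (fun t => (hxs t).1) hζ T (hx0 T) j).2
  have h2 : K₁ n m R G (G / R) C lam θ (∑ i, ‖x0 T i‖) ≤ a :=
    hC.K₁_mono hR.le hG.le (by positivity) le_rfl (by positivity) hS
  have h3 : K₂ n m r R G (G / R) C lam θ (pathVariation xs T)
      = b + 2 * n * m * R * pathVariation xs T := by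
    rw [hb, K₂, K₂]
    ring
  have hV0 : 0 ≤ pathVariation xs T := Finset.sum_nonneg fun _ _ => norm_nonneg _
  have hq : √((T : ℝ) + 1) ≤ 2 * √(T : ℝ) := by
    rw [Real.sqrt_le_left (by positivity), mul_pow, Real.sq_sqrt (by positivity)]
    linarith
  have hs : 0 < √(T : ℝ) := Real.sqrt_pos.2 (by linarith)
  have hTs : (T : ℝ) = √(T : ℝ) * √(T : ℝ) := (Real.mul_self_sqrt (by positivity)).symm
  rw [h3] at h1
  have h4 : (b + 2 * n * m * R * pathVariation xs T) * √((T : ℝ) + 1)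
      ≤ (b + 2 * n * m * R * pathVariation xs T) * (2 * √(T : ℝ)) := by gcongr
  calc (∫ ω, algRegret A Ω r f xs ζ (x0 T) T j ω ∂P) / (T : ℝ)
      ≤ (a + (b + 2 * n * m * R * pathVariation xs T) * (2 * √(T : ℝ))) / T := by
        gcongr
        linarith
    _ = a / T + ((b + 2 * n * m * R * pathVariation xs T) * (2 * √(T : ℝ)))
          / (√(T : ℝ) * √(T : ℝ)) := by rw [← hTs, add_div]
    _ = _ := by
      field_simp
      ring

end Regret

end ZODOO

open ZODOO in
theorem theorem2 (n m : ℕ) (hn : 1 ≤ n) (hm : 1 ≤ m)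
    (γ : ℝ) (hγ0 : 0 < γ) (hγ1 : γ < 1) (B : ℕ) (hB : 1 ≤ B) :
    -- admissible network constants exist and depend on `n`, `γ`, `B` only
    (∃ C lam θ : ℝ, ∀ A : ℕ → Matrix (Fin n) (Fin n) ℝ,
      NetworkAssumption A γ B → NetworkConstants A C lam θ) ∧
    ∀ A : ℕ → Matrix (Fin n) (Fin n) ℝ, NetworkAssumption A γ B →
    ∀ (Ω : Set (E m)) (r R G : ℝ) (f : Fin n → ℕ → E m → ℝ), CostAssumption Ω r R G f →
    ∀ xs : ℕ → E m, IsMinimizerSeq Ω f xs →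
    ∀ (S : Type*) [MeasurableSpace S] (P : Measure S) [IsProbabilityMeasure P]
      (ζ : Fin n → ℕ → S → Metric.sphere (0 : E m) 1), IsUniformNoise P ζ →
      -- the regret bound, for every choice of admissible network constants
      (∀ C lam θ : ℝ, NetworkConstants A C lam θ →
        ∀ T : ℕ, 1 ≤ T →
        ∀ x0 : Fin n → E m, (∀ i, x0 i ∈ (1 - xiT T) • Ω) →
        ∀ j : Fin n,
          Integrable (algRegret A Ω r f xs ζ x0 T j) P ∧
          -- with `L = m G / μ`
          (∫ ω, algRegret A Ω r f xs ζ x0 T j ω ∂P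
            ≤ K₁ n m R G (m * G / muT r T) C lam θ (∑ i, ‖x0 i‖)
              + K₂ n m r R G (m * G / muT r T) C lam θ (pathVariation xs T)
                * √((T : ℝ) + 1)) ∧
          -- with `L = G / R`, which does not depend on `T`
          (∫ ω, algRegret A Ω r f xs ζ x0 T j ω ∂P
            ≤ K₁ n m R G (G / R) C lam θ (∑ i, ‖x0 i‖)
              + K₂ n m r R G (G / R) C lam θ (pathVariation xs T) * √((T : ℝ) + 1))) ∧
      -- the average expected regret vanishes if the path variation is `o(√T)`
      ((fun T : ℕ => pathVariation xs T) =o[atTop] (fun T : ℕ => √(T : ℝ)) →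
        ∀ x0 : ℕ → Fin n → E m, (∀ T i, x0 T i ∈ (1 - xiT T) • Ω) →
        ∀ j : Fin n,
          Tendsto (fun T : ℕ => (∫ ω, algRegret A Ω r f xs ζ (x0 T) T j ω ∂P) / (T : ℝ))
            atTop (nhds 0)) := by
  refine ⟨exists_networkConstants n B hn hγ0 hγ1, ?_⟩
  intro A hA Ω r R G f hf xs hxs S _ P _ ζ hζ
  refine ⟨fun C lam θ hC T _ x0 hx0 j => ?_, fun hV x0 hx0 j => ?_⟩
  · obtain ⟨hint, hle⟩ := integral_algRegret_le hA hγ0 hC hm hf (fun t => (hxs t).1) hζ T hx0 j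
    have hL := hf.div_R_le hm T
    have hL0 : 0 ≤ G / R := div_nonneg hf.G_pos.le hf.R_pos.le
    exact ⟨hint, hle.trans (add_le_add
      (hC.K₁_mono hf.R_pos.le hf.G_pos.le hL0 hL (by positivity) le_rfl)
      (mul_le_mul_of_nonneg_right (hC.K₂_mono hf.R_pos.le hf.G_pos.le hL)
        (Real.sqrt_nonneg _))), hle⟩
  · obtain ⟨C, lam, θ, hC⟩ := exists_networkConstants n B hn hγ0 hγ1
    exact tendsto_integral_algRegret_div hA hγ0 (hC A hA) hm hf hxs hζ hV hx0 j
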